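/- Let $\mathbb W_t=\mathbb C[t]\langle\partial_t\rangle$ and $\mathbb W_\eta=\mathbb C[\eta]\langle\partial_\eta\rangle$ be the Weyl algebras, and let $\mathbb M$ be a holonomic left $\mathbb W_t$-module, in the sense that every $m\in\mathbb M$ is annihilated by some non-zero $P\in\mathbb W_t$. Its Fourier transform is $\widehat{\mathbb M}=\mathbb W_\eta\otimes_{\mathbb W_t}\mathbb M$, where $\mathbb W_\eta$ is a right $\mathbb W_t$-module through the morphism $t\mapsto-\partial_\eta$, $\partial_t\mapsto\eta$; put $\widehat m=1\otimes m$. Let $\mathcal E^{(\infty,0)}$ be the ring of formal sums $P=\sum_{i\le r}a_i(\eta)\,t^i$ ($r\in\mathbb Z$) such that all the power series $a_i$ converge in a common disk $|\eta|<\rho_0$ ($\rho_0>0$), and such that $\sum_{k\ge0}\|a_{-k}\|_\rho\,\theta^k/k!<\infty$ for some $0<\rho<\rho_0$ and some $\theta>0$, where $\|a\|_\rho=\sup_{|z|\le\rho}|a(z)|$; the multiplication is $P\cdot Q=\sum_{\alpha\ge0}\frac1{\alpha!}\,\partial_t^\alpha P\cdot\partial_\eta^\alpha Q$. Put $$\mathcal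 E^{(\infty,0)}(\mathbb M)=\mathcal E^{(\infty,0)}\otimes_{\mathbb W_t}\mathbb M,\qquad \mu(\mathbb N)=\mathcal E^{(\infty,0)}\otimes_{\mathbb W_\eta}\mathbb N$$ for a $\mathbb W_\eta$-module $\mathbb N$, where $\mathcal E^{(\infty,0)}$ is a right $\mathbb W_t$-module through $\varphi^{(\infty,0)}:\ t\mapsto -t,\ \partial_t\mapsto\eta$ and a right $\mathbb W_\eta$-module through $\mu:\ \eta\mapsto\eta,\ \partial_\eta\mapsto t$. Both are modules over $\mathbb C\{\eta\}\langle\partial_\eta\rangle$ (functions act by left multiplication, $\partial_\eta$ acts as left multiplication by $t$) and, by left multiplication, vector spaces over the field $\mathbb C\{t^{-1}\}[t]$ of convergent Laurent series in $t^{-1}$ and over the larger field $\mathbb C\{t^{-1}\}_1[t]$ of $1$-Gevrey Laurent series $\sum_{i\le r}c_i t^i$ (those for which $\sum_{k\ge0}c_{-k}x^k/k!$ has a positive radius of convergence). Then there is a well-defined additive bijection $$\Upsilon^0:\mu(\widehat{\mathbb M})\longrightarrow\mathcal E^{(\infty,0)}(\mathbb M),\qquad \alpha\otimes\widehat m\longmapsto\alpha\otimes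 m\quad(\alpha\in\mathcal E^{(\infty,0)},\ m\in\mathbb M),$$ and it is an isomorphism of $\mathbb C\{\eta\}\langle\partial_\eta\rangle$-modules, of $\mathbb C\{t^{-1}\}[t]$-vector spaces and of $\mathbb C\{t^{-1}\}_1[t]$-vector spaces. -/

import Mathlib

open scoped NNReal TensorProduct

noncomputable section

namespace LocalFourier

open HahnSeries (single ofPowerSeries ofSuppBddBelow coeff_eq_zero_of_lt_order coeff_add coeff_neg
  coeff_sub coeff_smul coeff_single_mul_add ofPowerSeries_apply_coeff ofPowerSeries_apply
  embDomain_of_notMem_range single_mul_single coeff_single_zero_mul coeff_single_of_ne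
  single_zero_one)

/-- Formal sums `∑_{i ≤ r} a_i(η) t^i` with `a_i ∈ ℂ⟦η⟧`, as Laurent series in `u = t⁻¹` over
`ℂ⟦η⟧`: the coefficient of `t^i` is `P.coeff (-i)`. The multiplication carried by this type is
the usual commutative one. -/
abbrev Symbol : Type := LaurentSeries (PowerSeries ℂ)

/-- The formal partial derivative `∂_η`, which acts on the coefficients. -/
def dEta : Symbol →ₗ[ℂ] Symbol where
  toFun P := P.map (PowerSeries.derivative ℂ)
  map_add' P Q := by ext1; funext n; simp
  map_smul' c P := by ext1; funext n; simp

/-- The formal partial derivative `∂_t`: it sends `a t^{-(n-1)}` to `(1-n) a t^{-n}`. -/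
def dT : Symbol →ₗ[ℂ] Symbol where
  toFun P := ofSuppBddBelow (fun n => (1 - n) • P.coeff (n - 1)) <| by
    refine ⟨P.order, fun n hn => ?_⟩
    contrapose! hn
    rw [Function.notMem_support, coeff_eq_zero_of_lt_order (by omega), smul_zero]
  map_add' P Q := by ext1; funext n; simp
  map_smul' c P := by ext1; funext n; simp

theorem smul_eq_single_mul (c : ℂ) (P : Symbol) : c • P = single 0 (PowerSeries.C c) * P := by
  ext1; funext n
  rw [coeff_single_zero_mul, coeff_smul, PowerSeries.smul_eq_C_mul]

instance : IsScalarTower ℂ Symbol Symbol := ⟨fun c P Q => by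
  rw [smul_eq_mul, smul_eq_mul, smul_eq_single_mul, smul_eq_single_mul, mul_assoc]⟩

instance : SMulCommClass ℂ Symbol Symbol := ⟨fun c P Q => by
  rw [smul_eq_mul, smul_eq_mul, smul_eq_single_mul, smul_eq_single_mul, mul_left_comm]⟩

theorem dEta_coeff (P : Symbol) (n : ℤ) :
    (dEta P).coeff n = PowerSeries.derivative ℂ (P.coeff n) := rfl

theorem dT_coeff (P : Symbol) (n : ℤ) : (dT P).coeff n = (1 - n) • P.coeff (n - 1) := rfl

theorem dT_coeff_succ (P : Symbol) (n : ℤ) : (dT P).coeff (n + 1) = (-n) • P.coeff n := by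
  rw [dT_coeff, add_sub_cancel_right]; congr 1; ring

/-- `LB p P`: only powers `t^i` with `i ≤ -p` occur in `P`. -/
def LB (p : ℤ) (P : Symbol) : Prop := ∀ n < p, P.coeff n = 0

theorem exists_LB (P : Symbol) : ∃ p, LB p P := ⟨P.order, fun _ h => coeff_eq_zero_of_lt_order h⟩

theorem LB.mono {p q : ℤ} {P : Symbol} (h : LB p P) (hq : q ≤ p) : LB q P :=
  fun n hn => h n (by omega)

theorem LB.zero (p : ℤ) : LB p (0 : Symbol) := fun _ _ => rfl

theorem LB.add {p : ℤ} {P Q : Symbol} (hP : LB p P) (hQ : LB p Q) : LB p (P + Q) := fun n hn => by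
  rw [coeff_add, hP n hn, hQ n hn, add_zero]

theorem LB.neg {p : ℤ} {P : Symbol} (hP : LB p P) : LB p (-P) := fun n hn => by
  rw [coeff_neg, hP n hn, neg_zero]

theorem LB.sub {p : ℤ} {P Q : Symbol} (hP : LB p P) (hQ : LB p Q) : LB p (P - Q) := by
  rw [sub_eq_add_neg]; exact hP.add hQ.neg

theorem LB.smul {p : ℤ} {P : Symbol} (c : ℂ) (hP : LB p P) : LB p (c • P) := fun n hn => by
  rw [coeff_smul, hP n hn, smul_zero]

theorem LB.sum {ι : Type*} {p : ℤ} {s : Finset ι} {f : ι → Symbol} (h : ∀ i ∈ s, LB p (f i)) :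
    LB p (∑ i ∈ s, f i) := by
  classical
  induction s using Finset.induction_on with
  | empty => exact LB.zero p
  | insert a s ha ih =>
    rw [Finset.sum_insert ha]
    exact (h a (by simp)).add (ih fun i hi => h i (by simp [hi]))

theorem LB.eq_shift {p : ℤ} {P : Symbol} (h : LB p P) :
    P = single p 1 * ofPowerSeries ℤ _ (PowerSeries.mk fun k : ℕ => P.coeff (p + k)) := by
  ext1; funext n
  obtain ⟨m, rfl⟩ : ∃ m, n = m + p := ⟨n - p, by omega⟩
  rw [coeff_single_mul_add, one_mul]
  by_cases hm : 0 ≤ m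
  · lift m to ℕ using hm
    rw [ofPowerSeries_apply_coeff, PowerSeries.coeff_mk, add_comm]
  · rw [h _ (by omega), ofPowerSeries_apply, embDomain_of_notMem_range]
    simp only [Nat.castOrderEmbedding_apply, Set.mem_range, not_exists]
    intro x hx; apply hm; rw [← show ((x : ℕ) : ℤ) = m from hx]; omega

theorem LB.coeff_mul {p q : ℤ} {P Q : Symbol} (hP : LB p P) (hQ : LB q Q) (m : ℕ) :
    (P * Q).coeff (p + q + m) =
      ∑ x ∈ Finset.HasAntidiagonal.antidiagonal m, P.coeff (p + x.1) * Q.coeff (q + x.2) := by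
  conv_lhs => rw [hP.eq_shift, hQ.eq_shift]
  rw [mul_mul_mul_comm, single_mul_single, ← map_mul, one_mul,
    add_comm (p + q), coeff_single_mul_add, one_mul, ofPowerSeries_apply_coeff,
    PowerSeries.coeff_mul]
  simp

theorem LB.mul {p q : ℤ} {P Q : Symbol} (hP : LB p P) (hQ : LB q Q) : LB (p + q) (P * Q) := by
  intro n hn
  rw [hP.eq_shift, hQ.eq_shift, mul_mul_mul_comm, single_mul_single, ← map_mul, one_mul]
  obtain ⟨m, rfl⟩ : ∃ m, n = m + (p + q) := ⟨n - (p + q), by omega⟩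
  rw [coeff_single_mul_add, one_mul, ofPowerSeries_apply, embDomain_of_notMem_range]
  simp only [Nat.castOrderEmbedding_apply, Set.mem_range, not_exists]
  intro x hx
  have : ((x : ℕ) : ℤ) = m := hx
  omega

theorem LB.dEta {p : ℤ} {P : Symbol} (h : LB p P) : LB p (dEta P) := fun n hn => by
  rw [dEta_coeff, h n hn, map_zero]

theorem LB.dT {p : ℤ} {P : Symbol} (h : LB p P) : LB (p + 1) (dT P) := fun n hn => by
  rw [dT_coeff, h _ (by omega), smul_zero]

theorem LB.dEta_pow {p : ℤ} {P : Symbol} (h : LB p P) (a : ℕ) :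
    LB p ((LocalFourier.dEta ^ a) P) := by
  induction a with
  | zero => simpa using h
  | succ a ih => rw [pow_succ', Module.End.mul_apply]; exact ih.dEta

theorem LB.dT_pow {p : ℤ} {P : Symbol} (h : LB p P) (a : ℕ) :
    LB (p + a) ((LocalFourier.dT ^ a) P) := by
  induction a with
  | zero => simpa using h
  | succ a ih =>
    rw [pow_succ', Module.End.mul_apply]
    exact ih.dT.mono (by push_cast; omega)

theorem LB.ext {p : ℤ} {P Q : Symbol} (hP : LB p P) (hQ : LB p Q)
    (h : ∀ m : ℕ, P.coeff (p + m) = Q.coeff (p + m)) : P = Q := by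
  ext1; funext n
  by_cases hn : n < p
  · rw [hP n hn, hQ n hn]
  · obtain ⟨m, rfl⟩ : ∃ m : ℕ, n = p + m := ⟨(n - p).toNat, by omega⟩
    exact h m

theorem dEta_mul (P Q : Symbol) : dEta (P * Q) = dEta P * Q + P * dEta Q := by
  obtain ⟨p, hP⟩ := exists_LB P
  obtain ⟨q, hQ⟩ := exists_LB Q
  refine LB.ext (hP.mul hQ).dEta ((hP.dEta.mul hQ).add (hP.mul hQ.dEta)) fun m => ?_
  rw [dEta_coeff, coeff_add, hP.coeff_mul hQ, hP.dEta.coeff_mul hQ, hP.coeff_mul hQ.dEta, map_sum,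
    ← Finset.sum_add_distrib]
  refine Finset.sum_congr rfl fun x _ => ?_
  rw [Derivation.leibniz, dEta_coeff, dEta_coeff, smul_eq_mul, smul_eq_mul]
  ring

theorem dT_mul (P Q : Symbol) : dT (P * Q) = dT P * Q + P * dT Q := by
  obtain ⟨p, hP⟩ := exists_LB P
  obtain ⟨q, hQ⟩ := exists_LB Q
  have h1 := hP.dT.mul hQ
  have h2 := hP.mul hQ.dT
  refine LB.ext (hP.mul hQ).dT ((h1.mono (by omega)).add (h2.mono (by omega))) fun m => ?_
  rw [coeff_add, show p + q + 1 + (m : ℤ) = (p + q + m) + 1 by ring, dT_coeff_succ,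
    show p + q + (m : ℤ) + 1 = p + 1 + q + m by ring, hP.dT.coeff_mul hQ,
    show p + 1 + q + (m : ℤ) = p + (q + 1) + m by ring, hP.coeff_mul hQ.dT,
    hP.coeff_mul hQ, ← Finset.sum_add_distrib, Finset.smul_sum]
  refine Finset.sum_congr rfl fun x hx => ?_
  rw [Finset.HasAntidiagonal.mem_antidiagonal] at hx
  rw [show p + 1 + (x.1 : ℤ) = p + x.1 + 1 by ring, show q + 1 + (x.2 : ℤ) = q + x.2 + 1 by ring,
    dT_coeff_succ, dT_coeff_succ, ← hx]
  simp only [zsmul_eq_mul]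
  push_cast
  ring

theorem dT_dEta (P : Symbol) : dT (dEta P) = dEta (dT P) := by
  ext1; funext n
  rw [dT_coeff, dEta_coeff, dEta_coeff, dT_coeff, map_zsmul]

theorem commute_dT_dEta : Commute dT dEta := LinearMap.ext dT_dEta

theorem leibniz_pow (d : Symbol →ₗ[ℂ] Symbol) (hd : ∀ P Q, d (P * Q) = d P * Q + P * d Q) (n : ℕ)
    (P Q : Symbol) : (d ^ n) (P * Q) =
      ∑ x ∈ Finset.HasAntidiagonal.antidiagonal n, n.choose x.1 • ((d ^ x.1) P * (d ^ x.2) Q) := by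
  induction n with
  | zero => simp
  | succ n ih =>
    rw [Finset.sum_antidiagonal_choose_succ_nsmul (fun i j => (d ^ i) P * (d ^ j) Q) n,
      pow_succ', Module.End.mul_apply, ih, map_sum, ← Finset.sum_add_distrib]
    refine Finset.sum_congr rfl fun x hx => ?_
    rw [map_nsmul, hd, smul_add, add_comm, pow_succ', pow_succ', Module.End.mul_apply,
      Module.End.mul_apply]
    congr 2
    rw [Finset.HasAntidiagonal.mem_antidiagonal] at hx
    rw [← hx, Nat.choose_symm_add]

theorem leibniz_div (d : Symbol →ₗ[ℂ] Symbol) (hd : ∀ P Q, d (P * Q) = d P * Q + P * d Q) (n : ℕ)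
    (P Q : Symbol) : (n.factorial : ℂ)⁻¹ • (d ^ n) (P * Q) =
      ∑ x ∈ Finset.HasAntidiagonal.antidiagonal n,
        ((x.1.factorial : ℂ)⁻¹ * (x.2.factorial : ℂ)⁻¹) • ((d ^ x.1) P * (d ^ x.2) Q) := by
  rw [leibniz_pow d hd, Finset.smul_sum]
  refine Finset.sum_congr rfl fun x hx => ?_
  rw [Finset.HasAntidiagonal.mem_antidiagonal] at hx
  subst hx
  rw [← Nat.cast_smul_eq_nsmul ℂ, smul_smul, Nat.choose_symm_add, Nat.add_choose, Nat.cast_div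
    (Nat.factorial_mul_factorial_dvd_factorial_add _ _) (by
      exact_mod_cast (Nat.mul_ne_zero (Nat.factorial_ne_zero _) (Nat.factorial_ne_zero _)))]
  congr 1
  have h1 : ((x.1 + x.2).factorial : ℂ) ≠ 0 := by exact_mod_cast Nat.factorial_ne_zero _
  have h2 : (x.1.factorial : ℂ) ≠ 0 := by exact_mod_cast Nat.factorial_ne_zero _
  have h3 : (x.2.factorial : ℂ) ≠ 0 := by exact_mod_cast Nat.factorial_ne_zero _
  push_cast
  field_simp

/-- The term of index `α` in the composition formula, `(1/α!) ∂_t^α P · ∂_η^α Q`. -/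
def starTerm (α : ℕ) (P Q : Symbol) : Symbol :=
  (α.factorial : ℂ)⁻¹ • ((dT ^ α) P * (dEta ^ α) Q)

theorem LB.starTerm {p q : ℤ} {P Q : Symbol} (hP : LB p P) (hQ : LB q Q) (α : ℕ) :
    LB (p + q + α) (starTerm α P Q) :=
  (((hP.dT_pow α).mul (hQ.dEta_pow α)).smul _).mono (by omega)

theorem finite_starTerm (P Q : Symbol) (n : ℤ) :
    (Function.support fun α : ℕ => (starTerm α P Q).coeff n).Finite := by
  obtain ⟨p, hP⟩ := exists_LB P
  obtain ⟨q, hQ⟩ := exists_LB Q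
  refine (Set.finite_Iio (n - p - q + 1).toNat).subset fun α hα => ?_
  by_contra h
  exact hα (hP.starTerm hQ α n (by simp at h; omega))

/-- The composition `P ∘ Q = ∑_{α ≥ 0} (1/α!) ∂_t^α P · ∂_η^α Q`. For each power of `t` only
finitely many terms of the sum contribute. -/
def star (P Q : Symbol) : Symbol :=
  ofSuppBddBelow (fun n => ∑ᶠ α : ℕ, (starTerm α P Q).coeff n) <| by
    obtain ⟨p, hP⟩ := exists_LB P
    obtain ⟨q, hQ⟩ := exists_LB Q
    refine ⟨p + q, fun n hn => ?_⟩
    contrapose! hn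
    rw [Function.notMem_support, finsum_eq_zero_of_forall_eq_zero]
    exact fun α => hP.starTerm hQ α n (by omega)

/-- The partial sums of the composition. -/
def starSum (N : ℕ) (P Q : Symbol) : Symbol := ∑ α ∈ Finset.range N, starTerm α P Q

theorem star_coeff (P Q : Symbol) (n : ℤ) :
    (star P Q).coeff n = ∑ᶠ α : ℕ, (starTerm α P Q).coeff n := rfl

theorem coeff_sum' {ι : Type*} (s : Finset ι) (f : ι → Symbol) (n : ℤ) :
    (∑ i ∈ s, f i).coeff n = ∑ i ∈ s, (f i).coeff n := by
  classical
  induction s using Finset.induction_on with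
  | empty => rfl
  | insert a s ha ih => rw [Finset.sum_insert ha, Finset.sum_insert ha, coeff_add, ih]

theorem LB.star_sub {p q : ℤ} {P Q : Symbol} (hP : LB p P) (hQ : LB q Q) (N : ℕ) :
    LB (p + q + N) (star P Q - starSum N P Q) := by
  intro n hn
  rw [coeff_sub, star_coeff, starSum, coeff_sum', finsum_eq_finsetSum_of_support_subset, sub_self]
  intro α hα
  by_contra h
  refine hα (hP.starTerm hQ α n ?_)
  simp at h
  omega

theorem starTerm_add_left (α : ℕ) (P P' Q : Symbol) :
    starTerm α (P + P') Q = starTerm α P Q + starTerm α P' Q := by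
  simp only [starTerm, map_add, add_mul, smul_add]

theorem starTerm_add_right (α : ℕ) (P Q Q' : Symbol) :
    starTerm α P (Q + Q') = starTerm α P Q + starTerm α P Q' := by
  simp only [starTerm, map_add, mul_add, smul_add]

theorem starTerm_smul_left (α : ℕ) (c : ℂ) (P Q : Symbol) :
    starTerm α (c • P) Q = c • starTerm α P Q := by
  simp only [starTerm, map_smul, smul_mul_assoc]
  rw [smul_comm]

theorem starTerm_smul_right (α : ℕ) (c : ℂ) (P Q : Symbol) :
    starTerm α P (c • Q) = c • starTerm α P Q := by
  simp only [starTerm, map_smul, mul_smul_comm]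
  rw [smul_comm]

theorem star_add_left (P P' Q : Symbol) : star (P + P') Q = star P Q + star P' Q := by
  ext1; funext n
  rw [coeff_add]
  simp only [star_coeff, starTerm_add_left, coeff_add]
  exact finsum_add_distrib (finite_starTerm _ _ _) (finite_starTerm _ _ _)

theorem star_add_right (P Q Q' : Symbol) : star P (Q + Q') = star P Q + star P Q' := by
  ext1; funext n
  rw [coeff_add]
  simp only [star_coeff, starTerm_add_right, coeff_add]
  exact finsum_add_distrib (finite_starTerm _ _ _) (finite_starTerm _ _ _)

theorem star_smul_left (c : ℂ) (P Q : Symbol) : star (c • P) Q = c • star P Q := by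
  ext1; funext n
  rw [coeff_smul]
  simp only [star_coeff, starTerm_smul_left, coeff_smul]
  exact (smul_finsum' c (finite_starTerm _ _ _)).symm

theorem star_smul_right (c : ℂ) (P Q : Symbol) : star P (c • Q) = c • star P Q := by
  ext1; funext n
  rw [coeff_smul]
  simp only [star_coeff, starTerm_smul_right, coeff_smul]
  exact (smul_finsum' c (finite_starTerm _ _ _)).symm

theorem LB.starSum {p q : ℤ} {P Q : Symbol} (hP : LB p P) (hQ : LB q Q) (N : ℕ) :
    LB (p + q) (starSum N P Q) :=
  LB.sum fun α _ => (hP.starTerm hQ α).mono (by omega)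

theorem LB.star {p q : ℤ} {P Q : Symbol} (hP : LB p P) (hQ : LB q Q) : LB (p + q) (star P Q) := by
  have := ((hP.star_sub hQ 0).mono (by omega : p + q ≤ _)).add (hP.starSum hQ 0)
  simpa using this

/-- The summands of a triple composition. -/
def triple (P Q R : Symbol) (x y z : ℕ) : Symbol :=
  ((x.factorial : ℂ)⁻¹ * (y.factorial : ℂ)⁻¹ * (z.factorial : ℂ)⁻¹) •
    ((dT ^ (x + y)) P * (dT ^ z) ((dEta ^ x) Q) * (dEta ^ (y + z)) R)

theorem LB.triple {p q r : ℤ} {P Q R : Symbol} (hP : LB p P) (hQ : LB q Q) (hR : LB r R)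
    (x y z : ℕ) : LB (p + q + r + (x + y + z : ℕ)) (triple P Q R x y z) :=
  ((((hP.dT_pow _).mul ((hQ.dEta_pow x).dT_pow z)).mul (hR.dEta_pow _)).smul _).mono
    (by push_cast; omega)

theorem pow_dT_dEta (a b : ℕ) (P : Symbol) :
    (dT ^ a) ((dEta ^ b) P) = (dEta ^ b) ((dT ^ a) P) := by
  have := (commute_dT_dEta.pow_pow a b)
  exact LinearMap.congr_fun this P

theorem starTerm_starTerm_left (P Q R : Symbol) (x α : ℕ) :
    starTerm α (starTerm x P Q) R =
      ∑ w ∈ Finset.HasAntidiagonal.antidiagonal α, triple P Q R x w.1 w.2 := by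
  rw [starTerm, ← smul_mul_assoc, starTerm, map_smul, smul_comm, leibniz_div dT dT_mul,
    Finset.smul_sum, Finset.sum_mul]
  refine Finset.sum_congr rfl fun w hw => ?_
  rw [Finset.HasAntidiagonal.mem_antidiagonal] at hw
  rw [triple, smul_mul_assoc, smul_mul_assoc, smul_smul, ← hw, ← Module.End.mul_apply, ← pow_add,
    add_comm w.1 x]
  congr 1
  ring

theorem starTerm_starTerm_right (P Q R : Symbol) (a z : ℕ) :
    starTerm a P (starTerm z Q R) =
      ∑ w ∈ Finset.HasAntidiagonal.antidiagonal a, triple P Q R w.1 w.2 z := by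
  rw [starTerm, ← mul_smul_comm, starTerm, map_smul, smul_comm, leibniz_div dEta dEta_mul,
    Finset.smul_sum, Finset.mul_sum]
  refine Finset.sum_congr rfl fun w hw => ?_
  rw [Finset.HasAntidiagonal.mem_antidiagonal] at hw
  rw [triple, mul_smul_comm, mul_smul_comm, smul_smul, ← hw,
    ← Module.End.mul_apply (dEta ^ w.2), ← pow_add, pow_dT_dEta, mul_assoc]
  congr 1
  · ring
  · rw [mul_assoc]

theorem LB.sum_triple {p q r : ℤ} {P Q R : Symbol} (hP : LB p P) (hQ : LB q Q) (hR : LB r R)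
    (N : ℕ) (s : Finset (ℕ × ℕ × ℕ)) :
    LB (p + q + r + N) ((∑ w ∈ s, LocalFourier.triple P Q R w.1 w.2.1 w.2.2) -
      ∑ w ∈ s with w.1 + w.2.1 + w.2.2 < N, LocalFourier.triple P Q R w.1 w.2.1 w.2.2) := by
  rw [← Finset.sum_filter_add_sum_filter_not s (fun w => w.1 + w.2.1 + w.2.2 < N),
    add_sub_cancel_left]
  refine LB.sum fun w hw => (hP.triple hQ hR w.1 w.2.1 w.2.2).mono ?_
  have := (Finset.mem_filter.mp hw).2
  omega

theorem starSum_add_left (N : ℕ) (P P' Q : Symbol) :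
    starSum N (P + P') Q = starSum N P Q + starSum N P' Q := by
  simp only [starSum, starTerm_add_left, Finset.sum_add_distrib]

theorem starSum_add_right (N : ℕ) (P Q Q' : Symbol) :
    starSum N P (Q + Q') = starSum N P Q + starSum N P Q' := by
  simp only [starSum, starTerm_add_right, Finset.sum_add_distrib]

theorem starTerm_sum_left {ι : Type*} (s : Finset ι) (f : ι → Symbol) (α : ℕ) (Q : Symbol) :
    starTerm α (∑ i ∈ s, f i) Q = ∑ i ∈ s, starTerm α (f i) Q := by
  simp only [starTerm, map_sum, Finset.sum_mul, Finset.smul_sum]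

theorem starTerm_sum_right {ι : Type*} (s : Finset ι) (f : ι → Symbol) (α : ℕ) (Q : Symbol) :
    starTerm α Q (∑ i ∈ s, f i) = ∑ i ∈ s, starTerm α Q (f i) := by
  simp only [starTerm, map_sum, Finset.mul_sum, Finset.smul_sum]

theorem starSum_starSum (N : ℕ) {p q r : ℤ} {P Q R : Symbol} (hP : LB p P) (hQ : LB q Q)
    (hR : LB r R) :
    LB (p + q + r + N) (starSum N (starSum N P Q) R - starSum N P (starSum N Q R)) := by
  have e1 : starSum N (starSum N P Q) R =
      ∑ w ∈ (Finset.range N ×ˢ (Finset.range N).sigma fun α => Finset.HasAntidiagonal.antidiagonal α).image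
        (fun w => (w.1, w.2.2)), triple P Q R w.1 w.2.1 w.2.2 := by
    rw [Finset.sum_image, Finset.sum_product, starSum, starSum]
    · simp only [starTerm_sum_left, starTerm_starTerm_left, Finset.sum_sigma]
      rw [Finset.sum_comm]
    · rintro ⟨x, α, y, z⟩ h ⟨x', α', y', z'⟩ h' e
      simp at h h' e
      obtain ⟨rfl, rfl, rfl⟩ := e
      obtain ⟨_, _, rfl⟩ := h
      obtain ⟨_, _, rfl⟩ := h'
      rfl
  have e2 : starSum N P (starSum N Q R) =
      ∑ w ∈ (Finset.range N ×ˢ (Finset.range N).sigma fun α => Finset.HasAntidiagonal.antidiagonal α).image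
        (fun w => (w.2.2.1, w.2.2.2, w.1)), triple P Q R w.1 w.2.1 w.2.2 := by
    rw [Finset.sum_image, Finset.sum_product, starSum, starSum]
    · simp only [starTerm_sum_right, starTerm_starTerm_right, Finset.sum_sigma]
      rw [Finset.sum_comm]
    · rintro ⟨x, α, y, z⟩ h ⟨x', α', y', z'⟩ h' e
      simp at h h' e
      obtain ⟨rfl, rfl, rfl⟩ := e
      obtain ⟨_, _, rfl⟩ := h
      obtain ⟨_, _, rfl⟩ := h'
      rfl
  rw [e1, e2]
  have h1 := hP.sum_triple hQ hR N (s := (Finset.range N ×ˢ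
      (Finset.range N).sigma fun α => Finset.HasAntidiagonal.antidiagonal α).image (fun w => (w.1, w.2.2)))
  have h2 := hP.sum_triple hQ hR N (s := (Finset.range N ×ˢ
      (Finset.range N).sigma fun α => Finset.HasAntidiagonal.antidiagonal α).image
        (fun w => (w.2.2.1, w.2.2.2, w.1)))
  have := h1.sub h2
  refine (congrArg (LB _) ?_).mp this
  rw [sub_sub_sub_comm]
  conv_rhs => rw [← sub_zero (_ - _)]
  congr 1
  rw [sub_eq_zero]
  refine Finset.sum_congr ?_ fun _ _ => rfl
  ext ⟨x, y, z⟩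
  simp only [Finset.mem_filter, Finset.mem_image, Finset.mem_product, Finset.mem_range,
    Finset.mem_sigma, Finset.HasAntidiagonal.mem_antidiagonal]
  constructor
  · rintro ⟨_, h⟩
    exact ⟨⟨⟨z, x + y, x, y⟩, ⟨by dsimp only; omega, by dsimp only; omega, rfl⟩, rfl⟩, h⟩
  · rintro ⟨_, h⟩
    exact ⟨⟨⟨x, y + z, y, z⟩, ⟨by dsimp only; omega, by dsimp only; omega, rfl⟩, rfl⟩, h⟩

theorem star_assoc (P Q R : Symbol) : star (star P Q) R = star P (star Q R) := by
  obtain ⟨p, hP⟩ := exists_LB P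
  obtain ⟨q, hQ⟩ := exists_LB Q
  obtain ⟨r, hR⟩ := exists_LB R
  rw [← sub_eq_zero]
  ext1; funext n
  let N := (n - p - q - r + 1).toNat
  have a1 := (hP.star hQ).star_sub hR N
  have a2 : LB (p + q + N + r) (starSum N (star P Q) R - starSum N (starSum N P Q) R) := by
    have := (hP.star_sub hQ N).starSum hR N
    refine (congrArg (LB _) ?_).mp this
    rw [eq_sub_iff_add_eq, ← starSum_add_left, sub_add_cancel]
  have a3 := starSum_starSum N hP hQ hR
  have a4 : LB (p + (q + r + N)) (starSum N P (star Q R) - starSum N P (starSum N Q R)) := by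
    have := hP.starSum (hQ.star_sub hR N) N
    refine (congrArg (LB _) ?_).mp this
    rw [eq_sub_iff_add_eq, ← starSum_add_right, sub_add_cancel]
  have a5 := hP.star_sub (hQ.star hR) N
  have key : LB (p + q + r + N) (star (star P Q) R - star P (star Q R)) := by
    have := (((a1.mono (q := p + q + r + N) (by omega)).add (a2.mono (by omega))).add a3).sub
      ((a4.mono (q := p + q + r + N) (by omega)).add (a5.mono (by omega)))
    refine (congrArg (LB _) ?_).mp this
    abel
  exact key n (by omega)

theorem starTerm_zero (P Q : Symbol) : starTerm 0 P Q = P * Q := by simp [starTerm]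

theorem star_of_dT_eq_zero {P : Symbol} (h : dT P = 0) (Q : Symbol) : star P Q = P * Q := by
  ext1; funext n
  rw [star_coeff, finsum_eq_single _ 0, starTerm_zero]
  intro α hα
  obtain ⟨a, rfl⟩ := Nat.exists_eq_succ_of_ne_zero hα
  rw [starTerm, pow_succ, Module.End.mul_apply, h]
  simp

theorem star_of_dEta_eq_zero {Q : Symbol} (h : dEta Q = 0) (P : Symbol) : star P Q = P * Q := by
  ext1; funext n
  rw [star_coeff, finsum_eq_single _ 0, starTerm_zero]
  intro α hα
  obtain ⟨a, rfl⟩ := Nat.exists_eq_succ_of_ne_zero hα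
  rw [starTerm, pow_succ dEta, Module.End.mul_apply, h]
  simp

theorem star_of_dT_dT_eq_zero {P : Symbol} (h : dT (dT P) = 0) (Q : Symbol) :
    star P Q = P * Q + dT P * dEta Q := by
  ext1; funext n
  rw [star_coeff, finsum_eq_sum_of_support_subset (s := {0, 1})]
  · rw [Finset.sum_pair zero_ne_one, starTerm_zero, coeff_add]
    simp [starTerm]
  · intro α hα
    by_contra hα'
    simp at hα'
    obtain ⟨a, rfl⟩ : ∃ a, α = a + 2 := ⟨α - 2, by omega⟩
    apply hα
    have h' : (dT ^ (a + 2)) P = 0 := by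
      rw [pow_add, Module.End.mul_apply, pow_two, Module.End.mul_apply, h, map_zero]
    simp [starTerm, h']

theorem dT_single_zero (a : PowerSeries ℂ) : dT (single 0 a) = 0 := by
  ext1; funext n
  rw [dT_coeff]
  by_cases h : n = 1
  · simp [h]
  · rw [coeff_single_of_ne (by omega), smul_zero]; rfl

theorem dT_one : dT 1 = 0 := dT_single_zero 1

theorem dEta_single (n : ℤ) (a : PowerSeries ℂ) :
    dEta (single n a) = single n (PowerSeries.derivative ℂ a) := by
  ext1; funext m
  rw [dEta_coeff]
  by_cases h : m = n
  · simp [h]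
  · rw [coeff_single_of_ne h, coeff_single_of_ne h, map_zero]

theorem dEta_one : dEta 1 = 0 := by
  rw [← single_zero_one, dEta_single]; simp

/-- The ring of formal operators `∑_{i ≤ r} a_i(η) t^i`: the additive group `Symbol`, with the
composition `star` as its multiplication. -/
def FormalOp : Type := Symbol

instance : AddCommGroup FormalOp := inferInstanceAs (AddCommGroup Symbol)

instance : Module ℂ FormalOp := inferInstanceAs (Module ℂ Symbol)

instance : Ring FormalOp :=
  { (inferInstance : AddCommGroup FormalOp) with
    mul := star
    one := (1 : Symbol)
    left_distrib := star_add_right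
    right_distrib := star_add_left
    zero_mul := fun P => by
      have h := star_add_left 0 0 P
      rw [add_zero] at h
      exact left_eq_add.mp h
    mul_zero := fun P => by
      have h := star_add_right P 0 0
      rw [add_zero] at h
      exact left_eq_add.mp h
    mul_assoc := star_assoc
    one_mul := fun P => (star_of_dT_eq_zero dT_one P).trans (one_mul (M := Symbol) P)
    mul_one := fun P => (star_of_dEta_eq_zero dEta_one P).trans (mul_one (M := Symbol) P) }

instance : Algebra ℂ FormalOp := Algebra.ofModule star_smul_left (fun c P Q => star_smul_right c P Q)

/-- `ℂ{x}_s`-membership: the series `∑ (a_n / (n!)^s) x^n` has a nonzero radius of convergence. -/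
def IsGevrey (s : ℝ≥0) (f : PowerSeries ℂ) : Prop :=
  ∃ r : ℝ, 0 < r ∧ ∀ z : ℂ, ‖z‖ < r →
    Summable fun n : ℕ => PowerSeries.coeff n f / (((n.factorial : ℝ) ^ (s : ℝ) : ℝ) : ℂ) * z ^ n

theorem exists_bound_of_summable {a : ℕ → ℂ} {r : ℝ} (hr : 0 < r)
    (h : ∀ z : ℂ, ‖z‖ < r → Summable fun n : ℕ => a n * z ^ n) :
    ∃ C R : ℝ, 0 ≤ C ∧ 1 ≤ R ∧ ∀ n, ‖a n‖ ≤ C * R ^ n := by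
  have hs := (h ((r / 2 : ℝ) : ℂ) (by
    rw [Complex.norm_real, Real.norm_of_nonneg (by positivity)]; linarith)).norm
  obtain ⟨C, hC⟩ := hs.tendsto_atTop_zero.bddAbove_range
  have hC' : ∀ n, ‖a n‖ * (r / 2) ^ n ≤ C := fun n => by
    have := hC ⟨n, rfl⟩
    simpa [abs_of_pos hr] using this
  have hC0 : 0 ≤ C := le_trans (by positivity) (hC' 0)
  refine ⟨C, max 1 (2 / r), hC0, le_max_left _ _, fun n => ?_⟩
  have h1 : ‖a n‖ ≤ C * (2 / r) ^ n := by
    have h2 : (2 / r) ^ n * (r / 2) ^ n = 1 := by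
      rw [← mul_pow]; field_simp; simp
    calc ‖a n‖ = (‖a n‖ * (r / 2) ^ n) * (2 / r) ^ n := by
          rw [mul_assoc, mul_comm ((r / 2) ^ n), h2, mul_one]
      _ ≤ _ := mul_le_mul_of_nonneg_right (hC' n) (by positivity)
  refine h1.trans (mul_le_mul_of_nonneg_left ?_ hC0)
  exact pow_le_pow_left₀ (by positivity) (le_max_right _ _) n

theorem summable_of_bound {a : ℕ → ℂ} {C R : ℝ} (hR : 1 ≤ R)
    (h : ∀ n, ‖a n‖ ≤ C * R ^ n) {z : ℂ} (hz : ‖z‖ < 1 / R) :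
    Summable fun n : ℕ => a n * z ^ n := by
  have hR0 : 0 < R := by linarith
  refine Summable.of_norm_bounded (g := fun n => C * (R * ‖z‖) ^ n)
    ((summable_geometric_of_lt_one (by positivity) ?_).mul_left C) fun n => ?_
  · rw [lt_div_iff₀ hR0] at hz; linarith
  · rw [norm_mul, norm_pow, mul_pow, ← mul_assoc]
    exact mul_le_mul_of_nonneg_right (h n) (by positivity)

theorem isGevrey_iff (s : ℝ≥0) (f : PowerSeries ℂ) : IsGevrey s f ↔
    ∃ C R : ℝ, 0 ≤ C ∧ 1 ≤ R ∧
      ∀ n : ℕ, ‖PowerSeries.coeff n f‖ ≤ C * R ^ n * (n.factorial : ℝ) ^ (s : ℝ) := by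
  have hpos : ∀ n : ℕ, 0 < (n.factorial : ℝ) ^ (s : ℝ) := fun n =>
    Real.rpow_pos_of_pos (by exact_mod_cast n.factorial_pos) _
  have hnorm : ∀ n : ℕ, ‖PowerSeries.coeff n f / (((n.factorial : ℝ) ^ (s : ℝ) : ℝ) : ℂ)‖ =
      ‖PowerSeries.coeff n f‖ / (n.factorial : ℝ) ^ (s : ℝ) := fun n => by
    rw [norm_div, Complex.norm_real, Real.norm_of_nonneg (hpos n).le]
  constructor
  · rintro ⟨r, hr, h⟩
    obtain ⟨C, R, hC, hR, hb⟩ := exists_bound_of_summable hr h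
    refine ⟨C, R, hC, hR, fun n => ?_⟩
    have := hb n
    rwa [hnorm, div_le_iff₀ (hpos n)] at this
  · rintro ⟨C, R, hC, hR, h⟩
    refine ⟨1 / R, by positivity, fun z hz => summable_of_bound (C := C) hR (fun n => ?_) hz⟩
    rw [hnorm, div_le_iff₀ (hpos n)]
    exact h n

/-- `‖a‖_ρ`, the supremum of `|a(z)|` over `|z| ≤ ρ`. -/
def supNorm (ρ : ℝ) (a : PowerSeries ℂ) : ℝ :=
  sSup ((fun z : ℂ => ‖∑' n : ℕ, PowerSeries.coeff n a * z ^ n‖) '' Metric.closedBall 0 ρ)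

theorem supNorm_nonneg (ρ : ℝ) (a : PowerSeries ℂ) : 0 ≤ supNorm ρ a := by
  refine Real.sSup_nonneg ?_
  rintro _ ⟨z, _, rfl⟩
  exact norm_nonneg _

theorem supNorm_le {ρ B : ℝ} {a : PowerSeries ℂ} (hB : 0 ≤ B)
    (h : ∀ z : ℂ, ‖z‖ ≤ ρ → ‖∑' n : ℕ, PowerSeries.coeff n a * z ^ n‖ ≤ B) :
    supNorm ρ a ≤ B := by
  refine Real.sSup_le ?_ hB
  rintro _ ⟨z, hz, rfl⟩
  exact h z (by simpa using hz)

theorem coeff_le_supNorm {ρ₀ ρ : ℝ} (hρ : 0 < ρ) (hρ₀ : ρ < ρ₀) {a : PowerSeries ℂ}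
    (h : ∀ z : ℂ, ‖z‖ < ρ₀ → Summable fun n : ℕ => PowerSeries.coeff n a * z ^ n) (n : ℕ) :
    ‖PowerSeries.coeff n a‖ ≤ supNorm ρ a * (1 / ρ) ^ n := by
  set c : ℕ → ℂ := fun n => PowerSeries.coeff n a with hc
  set f : ℂ → ℂ := fun z => ∑' n : ℕ, c n * z ^ n with hf
  have hsum : Summable fun n : ℕ => ‖c n‖ * ρ ^ n := by
    have := (h (ρ : ℂ) (by rwa [Complex.norm_real, Real.norm_of_nonneg hρ.le])).norm
    simpa [abs_of_pos hρ] using this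
  have hbdd : BddAbove ((fun z : ℂ => ‖∑' n : ℕ, PowerSeries.coeff n a * z ^ n‖) ''
      Metric.closedBall 0 ρ) := by
    refine ⟨∑' n, ‖c n‖ * ρ ^ n, ?_⟩
    rintro _ ⟨z, hz, rfl⟩
    have hz' : ‖z‖ ≤ ρ := by simpa using hz
    refine tsum_of_norm_bounded hsum.hasSum fun n => ?_
    rw [norm_mul, norm_pow]
    exact mul_le_mul_of_nonneg_left (pow_le_pow_left₀ (norm_nonneg _) hz' n) (norm_nonneg _)
  have hle : ∀ z : ℂ, ‖z‖ ≤ ρ → ‖f z‖ ≤ supNorm ρ a := fun z hz =>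
    le_csSup hbdd ⟨z, by simpa using hz, rfl⟩
  let p := FormalMultilinearSeries.ofScalars ℂ c
  obtain ⟨ρ₁, h1, h2⟩ := exists_between hρ₀
  have hρ1 : 0 < ρ₁ := hρ.trans h1
  have hrad : (ρ₁.toNNReal : ENNReal) ≤ p.radius := by
    refine p.le_radius_of_summable ?_
    have := (h (ρ₁ : ℂ) (by rwa [Complex.norm_real, Real.norm_of_nonneg hρ1.le])).norm
    refine Summable.of_nonneg_of_le (fun n => by positivity) (fun n => ?_) this
    rw [Real.coe_toNNReal _ hρ1.le, norm_mul, norm_pow, Complex.norm_real,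
      Real.norm_of_nonneg hρ1.le]
    refine mul_le_mul_of_nonneg_right ?_ (by positivity)
    rw [FormalMultilinearSeries.ofScalars_norm]
  have hps : HasFPowerSeriesOnBall f p 0 ρ₁.toNNReal := by
    have h0 := (p.hasFPowerSeriesOnBall (lt_of_lt_of_le (by simpa using hρ1) hrad)).mono
      (by simpa using hρ1) hrad
    refine h0.congr fun z _ => ?_
    simp only [FormalMultilinearSeries.sum, p, hf]
    refine tsum_congr fun n => ?_
    simp [mul_comm]
  have hdiff : DifferentiableOn ℂ f (Metric.ball 0 ρ₁) := by
    have := hps.differentiableOn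
    rwa [Metric.eball_coe, Real.coe_toNNReal _ hρ1.le] at this
  have hcl : DiffContOnCl ℂ f (Metric.ball 0 ρ) := by
    refine (hdiff.mono ?_).diffContOnCl
    exact (Metric.closure_ball_subset_closedBall).trans (Metric.closedBall_subset_ball h1)
  have hC := Complex.norm_iteratedDeriv_le_of_forall_mem_sphere_norm_le n hρ hcl
    (fun z hz => hle z (by simpa using (le_of_eq (by simpa using hz))))
  have hder : iteratedDeriv n f 0 = n.factorial * c n := by
    have := hps.hasFPowerSeriesAt.eq_formalMultilinearSeries
      (hps.analyticAt.hasFPowerSeriesAt)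
    have h3 := congrArg (fun q : FormalMultilinearSeries ℂ ℂ ℂ => q.coeff n) this
    simp only [p, FormalMultilinearSeries.coeff_ofScalars] at h3
    have hne : (n.factorial : ℂ) ≠ 0 := by exact_mod_cast n.factorial_ne_zero
    rw [h3]
    field_simp
  rw [hder, norm_mul, Complex.norm_natCast] at hC
  have hfac : (0 : ℝ) < n.factorial := by exact_mod_cast n.factorial_pos
  rw [mul_div_assoc, mul_le_mul_iff_right₀ hfac] at hC
  rw [one_div, inv_pow, ← div_eq_mul_inv]
  exact hC

/-- The growth condition on a formal sum `∑_{i ≤ r} a_i(η) t^i`: all `a_i` converge in a common disk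
`|η| < ρ₀`, and `∑_{k ≥ 0} ‖a_{-k}‖_ρ θ^k / k!` converges for some `0 < ρ < ρ₀` and some `θ > 0`. -/
def IsMicro (P : Symbol) : Prop :=
  ∃ ρ₀ : ℝ, 0 < ρ₀ ∧
    (∀ (i : ℤ) (z : ℂ), ‖z‖ < ρ₀ →
      Summable fun n : ℕ => PowerSeries.coeff n (P.coeff (-i)) * z ^ n) ∧
    ∃ ρ : ℝ, 0 < ρ ∧ ρ < ρ₀ ∧ ∃ θ : ℝ, 0 < θ ∧
      Summable fun k : ℕ => supNorm ρ (P.coeff k) * (θ ^ k / k.factorial)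

/-- An equivalent form of the growth condition in terms of the coefficients. -/
def Maj (p : ℤ) (P : Symbol) : Prop :=
  ∃ C R : ℝ, 0 ≤ C ∧ 1 ≤ R ∧ ∀ k n : ℕ,
    ‖PowerSeries.coeff n (P.coeff (p + k))‖ ≤ C * R ^ (k + n) * k.factorial

theorem factorial_add_le (a b : ℕ) :
    ((a + b).factorial : ℝ) ≤ 2 ^ (a + b) * (a.factorial * b.factorial) := by
  have h := Nat.add_choose_mul_factorial_mul_factorial a b
  have h2 := Nat.choose_le_two_pow (a + b) b
  have : (a + b).factorial ≤ 2 ^ (a + b) * (a.factorial * b.factorial) := by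
    rw [← h, mul_assoc]
    exact Nat.mul_le_mul_right _ h2
  exact_mod_cast this

theorem IsMicro.maj {r : ℕ} {P : Symbol} (h : IsMicro P) : Maj (-r) P := by
  obtain ⟨ρ₀, hρ₀, hconv, ρ, hρ, hρ', θ, hθ, hs⟩ := h
  obtain ⟨S, hS⟩ := hs.tendsto_atTop_zero.bddAbove_range
  have hS' : ∀ k : ℕ, supNorm ρ (P.coeff k) * (θ ^ k / k.factorial) ≤ S := fun k => hS ⟨k, rfl⟩
  have hS0 : 0 ≤ S := le_trans (mul_nonneg (supNorm_nonneg _ _) (by positivity)) (hS' 0)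
  set S' : ℝ := ∑ k ∈ Finset.range r, supNorm ρ (P.coeff (-r + k)) with hS'def
  have hS'0 : 0 ≤ S' := Finset.sum_nonneg fun k _ => supNorm_nonneg _ _
  set T : ℝ := max 1 (max (1 / θ) (1 / ρ)) with hT
  have hT1 : 1 ≤ T := le_max_left _ _
  have hTθ : 1 / θ ≤ T := (le_max_left _ _).trans (le_max_right _ _)
  have hTρ : 1 / ρ ≤ T := (le_max_right _ _).trans (le_max_right _ _)
  refine ⟨S + S', T, by positivity, hT1, fun k n => ?_⟩
  have hc : ‖PowerSeries.coeff n (P.coeff (-r + k))‖ ≤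
      supNorm ρ (P.coeff (-r + k)) * (1 / ρ) ^ n := by
    refine coeff_le_supNorm hρ hρ' (fun z hz => ?_) n
    have := hconv (r - k) z hz
    rwa [show -((r : ℤ) - k) = -r + k by ring] at this
  have hsup : supNorm ρ (P.coeff (-r + k)) ≤ (S + S') * T ^ k * k.factorial := by
    have hTk : 1 ≤ T ^ k := one_le_pow₀ hT1
    have hkf : (1 : ℝ) ≤ k.factorial := by exact_mod_cast k.factorial_pos
    by_cases hk : k < r
    · have : supNorm ρ (P.coeff (-r + k)) ≤ S' :=
        Finset.single_le_sum (f := fun k : ℕ => supNorm ρ (P.coeff (-r + k)))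
          (fun k _ => supNorm_nonneg _ _) (Finset.mem_range.mpr hk)
      calc _ ≤ S + S' := by linarith
        _ ≤ (S + S') * T ^ k := le_mul_of_one_le_right (by positivity) hTk
        _ ≤ _ := le_mul_of_one_le_right (by positivity) hkf
    · obtain ⟨j, rfl⟩ : ∃ j, k = r + j := ⟨k - r, by omega⟩
      rw [show -(r : ℤ) + ((r + j : ℕ) : ℤ) = j by push_cast; ring]
      have h1 := hS' j
      have hj : (0 : ℝ) < j.factorial := by exact_mod_cast j.factorial_pos
      have h2 : supNorm ρ (P.coeff j) ≤ S * (1 / θ) ^ j * j.factorial := by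
        rw [← mul_div_assoc, div_le_iff₀ hj] at h1
        rw [one_div, inv_pow, mul_assoc, mul_comm _ (j.factorial : ℝ), ← mul_assoc,
          ← div_eq_mul_inv, le_div_iff₀ (by positivity)]
        exact h1
      have h3 : (1 / θ) ^ j ≤ T ^ (r + j) :=
        (pow_le_pow_left₀ (by positivity) hTθ j).trans (pow_le_pow_right₀ hT1 (by omega))
      have h4 : (j.factorial : ℝ) ≤ (r + j).factorial := by
        exact_mod_cast Nat.factorial_le (by omega)
      refine h2.trans ?_
      gcongr
      linarith
  calc _ ≤ _ := hc
    _ ≤ ((S + S') * T ^ k * k.factorial) * T ^ n := by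
      refine mul_le_mul hsup ?_ (by positivity) (by positivity)
      exact pow_le_pow_left₀ (by positivity) hTρ n
    _ = _ := by rw [pow_add]; ring

theorem Maj.isMicro {r : ℕ} {P : Symbol} (hP : LB (-r) P) (h : Maj (-r) P) : IsMicro P := by
  obtain ⟨C, R, hC, hR, hb⟩ := h
  have hR0 : 0 < R := by linarith
  have hb' : ∀ k n : ℕ,
      ‖PowerSeries.coeff n (P.coeff (-r + k))‖ ≤ (C * R ^ k * k.factorial) * R ^ n := fun k n => by
    have := hb k n; rw [pow_add] at this; linarith
  refine ⟨1 / R, by positivity, fun i z hz => ?_, 1 / (2 * R), by positivity, ?_, 1 / (4 * R),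
    by positivity, ?_⟩
  · by_cases hi : -i < -r
    · rw [hP _ hi]; simp
    · obtain ⟨k, hk⟩ : ∃ k : ℕ, -i = -r + k := ⟨(-i + r).toNat, by omega⟩
      rw [hk]
      exact summable_of_bound hR (hb' k) hz
  · exact one_div_lt_one_div_of_lt hR0 (by linarith)
  · have hsup : ∀ k : ℕ, supNorm (1 / (2 * R)) (P.coeff (-r + k)) ≤
        (C * R ^ k * k.factorial) * 2 := fun k => by
      refine supNorm_le (by positivity) fun z hz => ?_
      refine tsum_of_norm_bounded (hasSum_geometric_two.mul_left _) fun n => ?_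
      rw [norm_mul, norm_pow]
      calc _ ≤ ((C * R ^ k * k.factorial) * R ^ n) * (1 / (2 * R)) ^ n :=
            mul_le_mul (hb' k n) (pow_le_pow_left₀ (norm_nonneg _) hz n) (by positivity)
              (by positivity)
        _ = _ := by
          rw [mul_assoc, ← mul_pow]; congr 2; field_simp
    refine Summable.of_nonneg_of_le
      (fun k => mul_nonneg (supNorm_nonneg _ _) (by positivity)) (fun k => ?_)
      ((summable_geometric_two).mul_left (C * R ^ r * 2 * 2 ^ r * r.factorial))
    have h1 := hsup (r + k)
    rw [show -(r : ℤ) + ((r + k : ℕ) : ℤ) = k by push_cast; ring] at h1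
    have h2 := factorial_add_le r k
    have hk : (0 : ℝ) < k.factorial := by exact_mod_cast k.factorial_pos
    calc _ ≤ (C * R ^ (r + k) * (r + k).factorial) * 2 * ((1 / (4 * R)) ^ k / k.factorial) :=
          mul_le_mul_of_nonneg_right h1 (by positivity)
      _ ≤ (C * R ^ (r + k) * (2 ^ (r + k) * (r.factorial * k.factorial))) * 2 *
          ((1 / (4 * R)) ^ k / k.factorial) := by gcongr
      _ = C * R ^ r * 2 * 2 ^ r * r.factorial * (R * 2 * (1 / (4 * R))) ^ k := by
        rw [mul_pow, mul_pow, pow_add, pow_add]; field_simp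
      _ = _ := by congr 2; field_simp; norm_num

theorem isMicro_iff {r : ℕ} {P : Symbol} (hP : LB (-r) P) : IsMicro P ↔ Maj (-r) P :=
  ⟨IsMicro.maj, Maj.isMicro hP⟩

theorem exists_LB_neg (P : Symbol) : ∃ r : ℕ, LB (-r) P := by
  obtain ⟨p, hp⟩ := exists_LB P
  exact ⟨(-p).toNat, hp.mono (by omega)⟩

theorem Maj.add {p : ℤ} {P Q : Symbol} (hP : Maj p P) (hQ : Maj p Q) : Maj p (P + Q) := by
  obtain ⟨C, R, hC, hR, h⟩ := hP
  obtain ⟨C', R', hC', hR', h'⟩ := hQ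
  refine ⟨C + C', max R R', by positivity, hR.trans (le_max_left _ _), fun k n => ?_⟩
  rw [coeff_add, map_add, add_mul, add_mul]
  have hR0 : 0 ≤ R := by linarith
  have hR0' : 0 ≤ R' := by linarith
  refine (norm_add_le _ _).trans (add_le_add ((h k n).trans ?_) ((h' k n).trans ?_))
  · gcongr; exact le_max_left _ _
  · gcongr; exact le_max_right _ _

theorem dT_pow_bound (p : ℤ) (P : Symbol) (α k n : ℕ) :
    ‖PowerSeries.coeff n (((dT ^ α) P).coeff (p + α + k))‖ * (p.natAbs + k).factorial ≤
      ((p.natAbs + k + α).factorial : ℝ) * ‖PowerSeries.coeff n (P.coeff (p + k))‖ := by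
  induction α with
  | zero => simp [mul_comm]
  | succ α ih =>
    rw [pow_succ', Module.End.mul_apply,
      show p + ((α + 1 : ℕ) : ℤ) + k = (p + α + k) + 1 by push_cast; ring, dT_coeff_succ, map_zsmul,
      zsmul_eq_mul, norm_mul, ← add_assoc, Nat.factorial_succ, Nat.cast_mul, mul_assoc, mul_assoc]
    refine mul_le_mul ?_ ih (by positivity) (by positivity)
    rw [Complex.norm_intCast, ← Int.cast_abs, ← Int.cast_natCast (R := ℝ), Int.cast_le]
    rw [abs_le]
    have := Int.natCast_natAbs p ▸ neg_abs_le p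
    constructor <;> push_cast <;> rcases abs_cases p with h | h <;> omega

theorem dEta_pow_bound (Q : Symbol) (i : ℤ) (α n : ℕ) :
    ‖PowerSeries.coeff n (((dEta ^ α) Q).coeff i)‖ * n.factorial =
      ((n + α).factorial : ℝ) * ‖PowerSeries.coeff (n + α) (Q.coeff i)‖ := by
  induction α generalizing n with
  | zero => simp [mul_comm]
  | succ α ih =>
    rw [pow_succ', Module.End.mul_apply, dEta_coeff, PowerSeries.coeff_derivative, norm_mul]
    have h := ih (n + 1)
    rw [Nat.factorial_succ, show n + 1 + α = n + (α + 1) by ring] at h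
    rw [← h]
    have : ‖((n : ℂ) + 1)‖ = ((n + 1 : ℕ) : ℝ) := by
      rw [← Complex.norm_natCast]; push_cast; rfl
    rw [this]
    push_cast
    ring

theorem star_coeff_add {p q : ℤ} {P Q : Symbol} (hP : LB p P) (hQ : LB q Q) (m : ℕ) :
    (star P Q).coeff (p + q + m) =
      ∑ α ∈ Finset.range (m + 1), (α.factorial : ℂ)⁻¹ •
        ∑ x ∈ Finset.HasAntidiagonal.antidiagonal (m - α),
          ((dT ^ α) P).coeff (p + α + x.1) * ((dEta ^ α) Q).coeff (q + x.2) := by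
  have h := hP.star_sub hQ (m + 1) (p + q + m) (by push_cast; omega)
  rw [coeff_sub, sub_eq_zero] at h
  rw [h, starSum, coeff_sum']
  refine Finset.sum_congr rfl fun α hα => ?_
  rw [starTerm, coeff_smul, ← (hP.dT_pow α).coeff_mul (hQ.dEta_pow α)]
  congr 2
  have := Finset.mem_range.mp hα
  omega

theorem star_term_bound {a b C C' R : ℝ} {A α k l i j : ℕ} (hC : 0 ≤ C) (hC' : 0 ≤ C')
    (hR : 1 ≤ R)
    (ha : a * (A + k).factorial ≤ (A + k + α).factorial * (C * R ^ (k + i) * k.factorial))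
    (hb : b * j.factorial ≤ (j + α).factorial * (C' * R ^ (l + (j + α)) * l.factorial))
    (hb0 : 0 ≤ b) :
    (α.factorial : ℝ)⁻¹ * (a * b) ≤ (C * C' * A.factorial * 2 ^ A) *
      (4 * R) ^ (α + k + l + (i + j)) * (α + k + l).factorial := by
  have hR0 : 0 < R := by linarith
  have fpos : ∀ n : ℕ, (0 : ℝ) < n.factorial := fun n => by exact_mod_cast n.factorial_pos
  have a1 : a ≤ (2 ^ (A + (k + α)) * (A.factorial * (k + α).factorial)) * (C * R ^ (k + i)) := by
    rw [← le_div_iff₀ (fpos _)] at ha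
    refine ha.trans ?_
    rw [div_le_iff₀ (fpos _)]
    have h1 := factorial_add_le A (k + α)
    rw [← add_assoc] at h1
    have h2 : (k.factorial : ℝ) ≤ (A + k).factorial := by
      exact_mod_cast Nat.factorial_le (by omega)
    calc ((A + k + α).factorial : ℝ) * (C * R ^ (k + i) * k.factorial)
        = (A + k + α).factorial * (C * R ^ (k + i)) * k.factorial := by ring
      _ ≤ _ := by rw [← add_assoc]; gcongr
  have b1 : (α.factorial : ℝ)⁻¹ * b ≤ 2 ^ (j + α) * (C' * R ^ (l + (j + α)) * l.factorial) := by
    rw [← le_div_iff₀ (fpos _)] at hb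
    rw [inv_mul_le_iff₀ (fpos _)]
    refine hb.trans ?_
    rw [div_le_iff₀ (fpos _)]
    have h1 := factorial_add_le j α
    calc _ ≤ (2 ^ (j + α) * (j.factorial * α.factorial)) *
          (C' * R ^ (l + (j + α)) * l.factorial) := by gcongr
      _ = _ := by ring
  have c1 : ((k + α).factorial : ℝ) * l.factorial ≤ (α + k + l).factorial := by
    rw [add_comm α k]
    exact_mod_cast Nat.le_of_dvd (Nat.factorial_pos _)
      (Nat.factorial_mul_factorial_dvd_factorial_add (k + α) l)
  calc (α.factorial : ℝ)⁻¹ * (a * b) = a * ((α.factorial : ℝ)⁻¹ * b) := by ring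
    _ ≤ ((2 ^ (A + (k + α)) * (A.factorial * (k + α).factorial)) * (C * R ^ (k + i))) *
        (2 ^ (j + α) * (C' * R ^ (l + (j + α)) * l.factorial)) :=
      mul_le_mul a1 b1 (mul_nonneg (inv_nonneg.mpr (fpos _).le) hb0) (by positivity)
    _ = (C * C' * A.factorial * 2 ^ A) * (2 ^ (k + α + j + α) * R ^ (α + k + l + (i + j))) *
        ((k + α).factorial * l.factorial) := by
      simp only [pow_add]; ring
    _ ≤ (C * C' * A.factorial * 2 ^ A) *
        (4 ^ (α + k + l + (i + j)) * R ^ (α + k + l + (i + j))) * (α + k + l).factorial := by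
      gcongr
      calc (2 : ℝ) ^ (k + α + j + α) ≤ 2 ^ (2 * (α + k + l + (i + j))) :=
            pow_le_pow_right₀ (by norm_num) (by omega)
        _ = _ := by rw [pow_mul]; norm_num
    _ = _ := by rw [mul_pow]

theorem Maj.star {p q : ℤ} {P Q : Symbol} (hP : LB p P) (hQ : LB q Q) (h : Maj p P)
    (h' : Maj q Q) : Maj (p + q) (star P Q) := by
  obtain ⟨C, R₁, hC, hR₁, hb₁⟩ := h
  obtain ⟨C', R₂, hC', hR₂, hb₂⟩ := h'
  set R := max R₁ R₂
  have hR : 1 ≤ R := hR₁.trans (le_max_left _ _)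
  have hb : ∀ k n : ℕ,
      ‖PowerSeries.coeff n (P.coeff (p + k))‖ ≤ C * R ^ (k + n) * k.factorial := fun k n => by
    refine (hb₁ k n).trans ?_
    gcongr
    exact le_max_left _ _
  have hb' : ∀ k n : ℕ,
      ‖PowerSeries.coeff n (Q.coeff (q + k))‖ ≤ C' * R ^ (k + n) * k.factorial := fun k n => by
    refine (hb₂ k n).trans ?_
    gcongr
    exact le_max_right _ _
  have hR0 : 0 < R := by linarith
  set D : ℝ := C * C' * p.natAbs.factorial * 2 ^ p.natAbs with hD
  have hD0 : 0 ≤ D := by positivity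
  refine ⟨D, 16 * R, hD0, by linarith, fun m n => ?_⟩
  set B : ℝ := D * (4 * R) ^ (m + n) * m.factorial with hB
  have hB0 : 0 ≤ B := by positivity
  have key : ‖PowerSeries.coeff n ((LocalFourier.star P Q).coeff (p + q + m))‖ ≤
      ∑ α ∈ Finset.range (m + 1), ∑ x ∈ Finset.HasAntidiagonal.antidiagonal (m - α),
        ∑ y ∈ Finset.HasAntidiagonal.antidiagonal n, B := by
    rw [star_coeff_add hP hQ, map_sum]
    refine norm_sum_le_of_le _ fun α hα => ?_
    rw [Finset.smul_sum, map_sum]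
    refine norm_sum_le_of_le _ fun x hx => ?_
    rw [PowerSeries.coeff_smul, PowerSeries.coeff_mul, smul_eq_mul, Finset.mul_sum]
    refine norm_sum_le_of_le _ fun y hy => ?_
    rw [Finset.HasAntidiagonal.mem_antidiagonal] at hx hy
    have hα' := Finset.mem_range.mp hα
    rw [norm_mul, norm_mul, norm_inv, Complex.norm_natCast]
    have := star_term_bound (A := p.natAbs) (α := α) (k := x.1) (l := x.2) (i := y.1) (j := y.2)
      hC hC' hR
      ((dT_pow_bound p P α x.1 y.1).trans (mul_le_mul_of_nonneg_left (hb x.1 y.1) (by positivity)))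
      ((dEta_pow_bound Q (q + x.2) α y.2).le.trans
        (mul_le_mul_of_nonneg_left (hb' x.2 (y.2 + α)) (by positivity)))
      (norm_nonneg _)
    rwa [hy, show α + x.1 + x.2 = m by omega] at this
  refine key.trans ?_
  have cnt : ∑ α ∈ Finset.range (m + 1), ∑ x ∈ Finset.HasAntidiagonal.antidiagonal (m - α),
        ∑ y ∈ Finset.HasAntidiagonal.antidiagonal n, B ≤ (2 ^ m * 2 ^ m * 2 ^ n) * B := by
    have two : ∀ n : ℕ, ((n : ℝ) + 1) ≤ 2 ^ n := fun n => by
      exact_mod_cast Nat.lt_two_pow_self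
    simp only [Finset.sum_const, Finset.Nat.card_antidiagonal, nsmul_eq_mul]
    calc _ ≤ ∑ α ∈ Finset.range (m + 1), (2 : ℝ) ^ m * (2 ^ n * B) := by
          refine Finset.sum_le_sum fun α _ => ?_
          have h1 : (((m - α + 1 : ℕ)) : ℝ) ≤ 2 ^ m := by
            refine le_trans ?_ (two m)
            have : m - α + 1 ≤ m + 1 := by omega
            exact_mod_cast this
          have h2 : ((n + 1 : ℕ) : ℝ) ≤ 2 ^ n := by exact_mod_cast two n
          gcongr
      _ ≤ _ := by
        rw [Finset.sum_const, Finset.card_range, nsmul_eq_mul]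
        have h2 : ((m + 1 : ℕ) : ℝ) ≤ 2 ^ m := by exact_mod_cast two m
        calc _ ≤ (2 : ℝ) ^ m * (2 ^ m * (2 ^ n * B)) := by gcongr
          _ = _ := by ring
  refine cnt.trans ?_
  calc (2 ^ m * 2 ^ m * 2 ^ n) * B ≤ (4 : ℝ) ^ (m + n) * B := by
        refine mul_le_mul_of_nonneg_right ?_ hB0
        rw [← mul_pow, pow_add]
        norm_num
        exact pow_le_pow_left₀ (by norm_num) (by norm_num) n
    _ = _ := by
      rw [hB, show (16 : ℝ) * R = 4 * (4 * R) by ring, mul_pow 4 (4 * R)]; ring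

theorem IsMicro.add {P Q : Symbol} (hP : IsMicro P) (hQ : IsMicro Q) : IsMicro (P + Q) := by
  obtain ⟨r, hr⟩ := exists_LB_neg P
  obtain ⟨s, hs⟩ := exists_LB_neg Q
  have h1 : LB (-(max r s : ℕ)) P := hr.mono (by push_cast; omega)
  have h2 : LB (-(max r s : ℕ)) Q := hs.mono (by push_cast; omega)
  exact (hP.maj.add hQ.maj).isMicro (h1.add h2)

theorem IsMicro.star {P Q : Symbol} (hP : IsMicro P) (hQ : IsMicro Q) :
    IsMicro (LocalFourier.star P Q) := by
  obtain ⟨r, hr⟩ := exists_LB_neg P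
  obtain ⟨s, hs⟩ := exists_LB_neg Q
  have h1 := Maj.star hr hs hP.maj hQ.maj
  have h2 := hr.star hs
  rw [show (-(r : ℤ) + -s) = -((r + s : ℕ) : ℤ) by push_cast; ring] at h1 h2
  exact h1.isMicro h2

theorem IsGevrey.zero (s : ℝ≥0) : IsGevrey s 0 :=
  (isGevrey_iff s 0).mpr ⟨0, 1, le_rfl, le_rfl, fun n => by simp⟩

theorem IsGevrey.C (s : ℝ≥0) (c : ℂ) : IsGevrey s (PowerSeries.C c) := by
  refine (isGevrey_iff s _).mpr ⟨‖c‖, 1, norm_nonneg _, le_rfl, fun n => ?_⟩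
  rw [PowerSeries.coeff_C]
  split_ifs with h
  · simp [h]
  · rw [norm_zero]; positivity

theorem IsGevrey.X (s : ℝ≥0) : IsGevrey s PowerSeries.X := by
  refine (isGevrey_iff s _).mpr ⟨1, 1, zero_le_one, le_rfl, fun n => ?_⟩
  rw [PowerSeries.coeff_X]
  split_ifs with h
  · simp [h]
  · rw [norm_zero]; positivity

theorem IsGevrey.add {s : ℝ≥0} {f g : PowerSeries ℂ} (hf : IsGevrey s f) (hg : IsGevrey s g) :
    IsGevrey s (f + g) := by
  obtain ⟨C, R, hC, hR, h⟩ := (isGevrey_iff s f).mp hf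
  obtain ⟨C', R', hC', hR', h'⟩ := (isGevrey_iff s g).mp hg
  refine (isGevrey_iff s _).mpr
    ⟨C + C', max R R', by positivity, hR.trans (le_max_left _ _), fun n => ?_⟩
  have hR0 : 0 ≤ R := by linarith
  have hR0' : 0 ≤ R' := by linarith
  rw [map_add, add_mul, add_mul]
  refine (norm_add_le _ _).trans (add_le_add ((h n).trans ?_) ((h' n).trans ?_))
  · gcongr; exact le_max_left _ _
  · gcongr; exact le_max_right _ _

theorem factorial_rpow_mul_le (s : ℝ≥0) (i j : ℕ) :
    (i.factorial : ℝ) ^ (s : ℝ) * (j.factorial : ℝ) ^ (s : ℝ) ≤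
      ((i + j).factorial : ℝ) ^ (s : ℝ) := by
  rw [← Real.mul_rpow (by positivity) (by positivity)]
  refine Real.rpow_le_rpow (by positivity) ?_ s.2
  exact_mod_cast Nat.le_of_dvd (Nat.factorial_pos _) (Nat.factorial_mul_factorial_dvd_factorial_add i j)

theorem succ_le_two_pow (n : ℕ) : ((n : ℝ) + 1) ≤ 2 ^ n := by
  exact_mod_cast Nat.lt_two_pow_self

theorem IsGevrey.mul {s : ℝ≥0} {f g : PowerSeries ℂ} (hf : IsGevrey s f) (hg : IsGevrey s g) :
    IsGevrey s (f * g) := by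
  obtain ⟨C, R, hC, hR, h⟩ := (isGevrey_iff s f).mp hf
  obtain ⟨C', R', hC', hR', h'⟩ := (isGevrey_iff s g).mp hg
  have hR0 : 0 < R := by linarith
  have hR0' : 0 < R' := by linarith
  refine (isGevrey_iff s _).mpr
    ⟨C * C', 2 * (R * R'), by positivity, by nlinarith, fun n => ?_⟩
  have key : ‖PowerSeries.coeff n (f * g)‖ ≤ ∑ _x ∈ Finset.HasAntidiagonal.antidiagonal n,
      C * C' * (R * R') ^ n * (n.factorial : ℝ) ^ (s : ℝ) := by
    rw [PowerSeries.coeff_mul]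
    refine norm_sum_le_of_le _ fun x hx => ?_
    rw [Finset.HasAntidiagonal.mem_antidiagonal] at hx
    have h1 : R ^ x.1 ≤ R ^ n := pow_le_pow_right₀ hR (by omega)
    have h2 : R' ^ x.2 ≤ R' ^ n := pow_le_pow_right₀ hR' (by omega)
    have h3 := factorial_rpow_mul_le s x.1 x.2
    rw [hx] at h3
    rw [norm_mul]
    calc _ ≤ (C * R ^ x.1 * (x.1.factorial : ℝ) ^ (s : ℝ)) *
          (C' * R' ^ x.2 * (x.2.factorial : ℝ) ^ (s : ℝ)) :=
          mul_le_mul (h _) (h' _) (norm_nonneg _) (by positivity)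
      _ = C * C' * (R ^ x.1 * R' ^ x.2) *
          ((x.1.factorial : ℝ) ^ (s : ℝ) * (x.2.factorial : ℝ) ^ (s : ℝ)) := by ring
      _ ≤ C * C' * (R ^ n * R' ^ n) * (n.factorial : ℝ) ^ (s : ℝ) := by gcongr
      _ = _ := by rw [mul_pow]
  refine key.trans ?_
  rw [Finset.sum_const, Finset.Nat.card_antidiagonal, nsmul_eq_mul, mul_pow 2]
  have := succ_le_two_pow n
  calc _ ≤ (2 : ℝ) ^ n * (C * C' * (R * R') ^ n * (n.factorial : ℝ) ^ (s : ℝ)) := by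
        push_cast; gcongr
    _ = _ := by ring

theorem IsGevrey.derivative {s : ℝ≥0} {f : PowerSeries ℂ} (hf : IsGevrey s f) :
    IsGevrey s (PowerSeries.derivative ℂ f) := by
  obtain ⟨C, R, hC, hR, h⟩ := (isGevrey_iff s f).mp hf
  have hR0 : 0 < R := by linarith
  set T : ℝ := (2 : ℝ) ^ (s : ℝ) with hT
  have hT1 : 1 ≤ T := Real.one_le_rpow (by norm_num) s.2
  refine (isGevrey_iff s _).mpr
    ⟨C * R, R * (T * 2), by positivity, by nlinarith, fun n => ?_⟩
  rw [PowerSeries.coeff_derivative, norm_mul]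
  have e : ‖((n : ℂ) + 1)‖ = ((n + 1 : ℕ) : ℝ) := by
    rw [← Complex.norm_natCast]; push_cast; rfl
  have h2 : ((n + 1 : ℕ) : ℝ) ≤ 2 ^ n := by exact_mod_cast succ_le_two_pow n
  have h3 : ((n + 1).factorial : ℝ) ^ (s : ℝ) ≤ T ^ n * (n.factorial : ℝ) ^ (s : ℝ) := by
    rw [Nat.factorial_succ, Nat.cast_mul, Real.mul_rpow (by positivity) (by positivity)]
    refine mul_le_mul_of_nonneg_right ?_ (by positivity)
    calc _ ≤ ((2 : ℝ) ^ n) ^ (s : ℝ) := Real.rpow_le_rpow (by positivity) h2 s.2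
      _ = T ^ n := by
        rw [hT, ← Real.rpow_natCast, ← Real.rpow_natCast, ← Real.rpow_mul (by norm_num),
          ← Real.rpow_mul (by norm_num), mul_comm]
  rw [e]
  calc _ ≤ (C * R ^ (n + 1) * ((n + 1).factorial : ℝ) ^ (s : ℝ)) * ((n + 1 : ℕ) : ℝ) :=
        mul_le_mul_of_nonneg_right (h _) (by positivity)
    _ ≤ (C * R ^ (n + 1) * (T ^ n * (n.factorial : ℝ) ^ (s : ℝ))) * 2 ^ n := by gcongr
    _ = _ := by rw [mul_pow, mul_pow, pow_succ]; ring

theorem geom_bound (c R : ℝ) (n : ℕ) :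
    c * ∑ i ∈ Finset.range n, R ^ (n - i) * (R * (1 + c)) ^ i = (R * (1 + c)) ^ n - R ^ n := by
  induction n with
  | zero => simp
  | succ n ih =>
    rw [Finset.sum_range_succ]
    have : ∑ i ∈ Finset.range n, R ^ (n + 1 - i) * (R * (1 + c)) ^ i =
        R * ∑ i ∈ Finset.range n, R ^ (n - i) * (R * (1 + c)) ^ i := by
      rw [Finset.mul_sum]
      refine Finset.sum_congr rfl fun i hi => ?_
      have := Finset.mem_range.mp hi
      rw [show n + 1 - i = (n - i) + 1 by omega, pow_succ]; ring
    rw [this, show n + 1 - n = 1 by omega, pow_one, pow_succ, pow_succ]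
    linear_combination R * ih

theorem IsGevrey.inv {s : ℝ≥0} {f : PowerSeries ℂ} (hf : IsGevrey s f)
    (h0 : PowerSeries.constantCoeff f ≠ 0) : IsGevrey s f⁻¹ := by
  obtain ⟨C, R, hC, hR, h⟩ := (isGevrey_iff s f).mp hf
  have hR0 : 0 < R := by linarith
  set a := PowerSeries.constantCoeff f with ha
  have ha0 : 0 < ‖a‖ := norm_pos_iff.mpr h0
  set c : ℝ := ‖a‖⁻¹ * C with hc
  have hc0 : 0 ≤ c := by positivity
  refine (isGevrey_iff s _).mpr
    ⟨‖a‖⁻¹, R * (1 + c), by positivity, by nlinarith, fun n => ?_⟩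
  induction n using Nat.strong_induction_on with
  | _ n ih =>
    rcases Nat.eq_zero_or_pos n with rfl | hn
    · simp [ha]
    rw [PowerSeries.coeff_inv, if_neg hn.ne', norm_mul, norm_neg, norm_inv]
    have key : ‖∑ x ∈ Finset.HasAntidiagonal.antidiagonal n, if x.2 < n then
        PowerSeries.coeff x.1 f * PowerSeries.coeff x.2 f⁻¹ else 0‖ ≤
        ∑ i ∈ Finset.range n, (C * ‖a‖⁻¹ * (n.factorial : ℝ) ^ (s : ℝ)) *
          (R ^ (n - i) * (R * (1 + c)) ^ i) := by
      rw [← Finset.Nat.sum_antidiagonal_swap, Finset.Nat.sum_antidiagonal_eq_sum_range_succ_mk,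
        Finset.sum_range_succ, if_neg (by simp), add_zero]
      refine norm_sum_le_of_le _ fun i hi => ?_
      have hi' := Finset.mem_range.mp hi
      simp only [Prod.fst_swap, Prod.snd_swap]
      rw [if_pos hi', norm_mul]
      have h3 := factorial_rpow_mul_le s (n - i) i
      rw [Nat.sub_add_cancel hi'.le] at h3
      calc _ ≤ (C * R ^ (n - i) * ((n - i).factorial : ℝ) ^ (s : ℝ)) *
            (‖a‖⁻¹ * (R * (1 + c)) ^ i * (i.factorial : ℝ) ^ (s : ℝ)) :=
            mul_le_mul (h _) (ih i hi') (norm_nonneg _) (by positivity)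
        _ = (C * ‖a‖⁻¹ * (((n - i).factorial : ℝ) ^ (s : ℝ) * (i.factorial : ℝ) ^ (s : ℝ))) *
            (R ^ (n - i) * (R * (1 + c)) ^ i) := by ring
        _ ≤ _ := by gcongr
    refine (mul_le_mul_of_nonneg_left key (by positivity)).trans ?_
    rw [← Finset.mul_sum]
    have g := geom_bound c R n
    calc _ = ‖a‖⁻¹ * (n.factorial : ℝ) ^ (s : ℝ) *
          (c * ∑ i ∈ Finset.range n, R ^ (n - i) * (R * (1 + c)) ^ i) := by rw [hc]; ring
      _ ≤ ‖a‖⁻¹ * (n.factorial : ℝ) ^ (s : ℝ) * (R * (1 + c)) ^ n := by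
        rw [g]
        have : 0 ≤ R ^ n := by positivity
        gcongr
        linarith
      _ = _ := by ring

theorem IsGevrey.divXPowOrder {s : ℝ≥0} {f : PowerSeries ℂ} (hf : IsGevrey s f) :
    IsGevrey s f.divXPowOrder := by
  obtain ⟨C, R, hC, hR, h⟩ := (isGevrey_iff s f).mp hf
  have hR0 : 0 < R := by linarith
  set d := f.order.toNat with hd
  set T : ℝ := (2 : ℝ) ^ (s : ℝ) with hT
  have hT1 : 1 ≤ T := Real.one_le_rpow (by norm_num) s.2
  refine (isGevrey_iff s _).mpr ⟨C * R ^ d * T ^ d * (d.factorial : ℝ) ^ (s : ℝ), R * T,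
    by positivity, by nlinarith, fun n => ?_⟩
  rw [PowerSeries.coeff_divXPowOrder, ← hd]
  have h3 : ((n + d).factorial : ℝ) ^ (s : ℝ) ≤
      T ^ (n + d) * ((n.factorial : ℝ) ^ (s : ℝ) * (d.factorial : ℝ) ^ (s : ℝ)) := by
    have e : T ^ (n + d) = ((2 : ℝ) ^ (n + d)) ^ (s : ℝ) := by
      rw [hT, ← Real.rpow_natCast, ← Real.rpow_natCast, ← Real.rpow_mul (by norm_num),
          ← Real.rpow_mul (by norm_num), mul_comm]
    rw [e, ← Real.mul_rpow (by positivity) (by positivity),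
      ← Real.mul_rpow (by positivity) (by positivity)]
    exact Real.rpow_le_rpow (by positivity) (factorial_add_le n d) s.2
  calc _ ≤ _ := h _
    _ ≤ C * R ^ (n + d) * (T ^ (n + d) *
        ((n.factorial : ℝ) ^ (s : ℝ) * (d.factorial : ℝ) ^ (s : ℝ))) := by gcongr
    _ = _ := by rw [mul_pow, pow_add, pow_add]; ring

/-- `ℂ{x}_s`, the ring of `s`-Gevrey power series. -/
def GevreySeries (s : ℝ≥0) : Subalgebra ℂ (PowerSeries ℂ) where
  carrier := {f | IsGevrey s f}
  mul_mem' := IsGevrey.mul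
  add_mem' := IsGevrey.add
  algebraMap_mem' c := IsGevrey.C s c

/-- `f = x^{-k} g` for some `k` and some `s`-Gevrey power series `g`. -/
def IsGevreyLaurent (s : ℝ≥0) (f : LaurentSeries ℂ) : Prop :=
  ∃ (k : ℕ) (g : PowerSeries ℂ), IsGevrey s g ∧ f = single (-k : ℤ) 1 * ofPowerSeries ℤ ℂ g

theorem IsGevrey.X_pow_mul {s : ℝ≥0} {g : PowerSeries ℂ} (hg : IsGevrey s g) (k : ℕ) :
    IsGevrey s (PowerSeries.X ^ k * g) :=
  IsGevrey.mul (pow_mem (S := GevreySeries s) (show PowerSeries.X ∈ GevreySeries s from IsGevrey.X s) k) hg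

theorem single_neg_shift (k l : ℕ) (g : PowerSeries ℂ) :
    single (-((k + l : ℕ) : ℤ)) 1 * ofPowerSeries ℤ ℂ (PowerSeries.X ^ l * g) =
      single (-k : ℤ) 1 * ofPowerSeries ℤ ℂ g := by
  rw [map_mul, HahnSeries.ofPowerSeries_X_pow, ← mul_assoc, single_mul_single, mul_one,
    show (-((k + l : ℕ) : ℤ) + l) = -k by push_cast; ring]

theorem IsGevreyLaurent.ofGevrey {s : ℝ≥0} {g : PowerSeries ℂ} (hg : IsGevrey s g) :
    IsGevreyLaurent s (ofPowerSeries ℤ ℂ g) :=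
  ⟨0, g, hg, by simp⟩

/-- `K^s = ℂ{x}_s[x⁻¹]`, the field of `s`-Gevrey Laurent series. For `s = 0` this is the field
`ℂ{x}[x⁻¹]` of convergent Laurent series. -/
def GevreyField (s : ℝ≥0) : Subfield (LaurentSeries ℂ) where
  carrier := {f | IsGevreyLaurent s f}
  mul_mem' := by
    rintro _ _ ⟨k, g, hg, rfl⟩ ⟨l, h, hh, rfl⟩
    refine ⟨k + l, g * h, hg.mul hh, ?_⟩
    rw [mul_mul_mul_comm, single_mul_single, map_mul (ofPowerSeries ℤ ℂ), one_mul,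
      show (-(k : ℤ) + -l) = -((k + l : ℕ) : ℤ) by push_cast; ring]
  one_mem' := by
    have := IsGevreyLaurent.ofGevrey (IsGevrey.C s 1)
    simpa using this
  zero_mem' := by
    have := IsGevreyLaurent.ofGevrey (IsGevrey.zero s)
    simpa using this
  add_mem' := by
    rintro _ _ ⟨k, g, hg, rfl⟩ ⟨l, h, hh, rfl⟩
    refine ⟨k + l, PowerSeries.X ^ l * g + PowerSeries.X ^ k * h,
      (hg.X_pow_mul l).add (hh.X_pow_mul k), ?_⟩
    rw [map_add, mul_add, single_neg_shift, add_comm k l, single_neg_shift]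
  neg_mem' := by
    rintro _ ⟨k, g, hg, rfl⟩
    refine ⟨k, PowerSeries.C (-1) * g, (IsGevrey.C s (-1)).mul hg, ?_⟩
    simp only [map_neg, map_one, neg_mul, one_mul]
    exact neg_mul_eq_mul_neg (α := LaurentSeries ℂ) _ _
  inv_mem' := by
    rintro f ⟨k, g, hg, rfl⟩
    by_cases hg0 : g = 0
    · subst hg0
      have := IsGevreyLaurent.ofGevrey (IsGevrey.zero s)
      simpa using this
    have hu := hg.divXPowOrder
    set u := g.divXPowOrder with hudef
    set d := g.order.toNat with hd
    have hgu : PowerSeries.X ^ d * u = g := PowerSeries.X_pow_order_mul_divXPowOrder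
    have hu0 : PowerSeries.constantCoeff u ≠ 0 := by
      simpa [hudef, PowerSeries.constantCoeff_divXPowOrder_eq_zero_iff] using hg0
    refine ⟨d, PowerSeries.X ^ k * u⁻¹, (hu.inv hu0).X_pow_mul k, ?_⟩
    refine inv_eq_of_mul_eq_one_right ?_
    rw [mul_mul_mul_comm, single_mul_single, ← map_mul (ofPowerSeries ℤ ℂ), ← hgu,
      mul_mul_mul_comm, PowerSeries.mul_inv_cancel _ hu0, mul_one, ← pow_add, mul_one,
      HahnSeries.ofPowerSeries_X_pow, single_mul_single, mul_one,
      show (-(k : ℤ) + -d + ((d + k : ℕ) : ℤ)) = 0 by push_cast; ring, single_zero_one]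

theorem LB.single (r : ℤ) (a : PowerSeries ℂ) : LB r (single r a) := fun n hn =>
  coeff_single_of_ne (by omega)

theorem isMicro_single (r : ℕ) {a : PowerSeries ℂ} (ha : IsGevrey 0 a) :
    IsMicro (single (-r : ℤ) a) := by
  obtain ⟨C, R, hC, hR, h⟩ := (isGevrey_iff 0 a).mp ha
  refine Maj.isMicro (LB.single _ a) ⟨C, R, hC, hR, fun k n => ?_⟩
  rcases Nat.eq_zero_or_pos k with rfl | hk
  · simpa using h n
  · rw [coeff_single_of_ne (by omega), map_zero, norm_zero]
    have hR0 : 0 < R := by linarith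
    positivity

/-- The ring `E^(∞,0)`: the formal operators `∑_{i ≤ r} a_i(η) t^i` that satisfy the growth
condition, with the multiplication `P ∘ Q = ∑ (1/α!) ∂_t^α P · ∂_η^α Q`. -/
def MicroRing : Subalgebra ℂ FormalOp where
  carrier := {P | IsMicro P}
  mul_mem' := IsMicro.star
  add_mem' := IsMicro.add
  algebraMap_mem' c := by
    have h : algebraMap ℂ FormalOp c = (single 0 (PowerSeries.C c) : Symbol) := by
      rw [Algebra.algebraMap_eq_smul_one]
      exact (smul_eq_single_mul c (1 : Symbol)).trans (mul_one _)
    rw [h]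
    exact isMicro_single 0 (IsGevrey.C 0 c)

/-- `ℂ{η}`, the ring of convergent power series. -/
abbrev ConvSeries : Type := GevreySeries 0

/-- The derivation `d/dη` of `ℂ{η}`. -/
def ConvSeries.deriv (a : ConvSeries) : ConvSeries :=
  ⟨PowerSeries.derivative ℂ (a : PowerSeries ℂ), IsGevrey.derivative a.2⟩

namespace MicroRing

/-- A convergent series `a(η)`, as an operator of order zero. -/
def ofConv (a : ConvSeries) : MicroRing := ⟨(single 0 (a : PowerSeries ℂ) : Symbol), isMicro_single 0 a.2⟩

/-- The element `η`. -/
def eta : MicroRing := ofConv ⟨PowerSeries.X, IsGevrey.X 0⟩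

/-- The element `t`. -/
def t : MicroRing := ⟨(single (-1) 1 : Symbol), isMicro_single 1 (by simpa using IsGevrey.C 0 1)⟩

theorem ofConv_add (a b : ConvSeries) : ofConv (a + b) = ofConv a + ofConv b :=
  Subtype.ext (map_add (HahnSeries.single.addMonoidHom (0 : ℤ)) (a : PowerSeries ℂ) b)

theorem ofConv_mul (a b : ConvSeries) : ofConv (a * b) = ofConv a * ofConv b := by
  refine Subtype.ext (Eq.symm ?_)
  refine (star_of_dT_eq_zero (dT_single_zero _) _).trans ?_
  exact (single_mul_single).trans (by rw [add_zero]; rfl)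

theorem ofConv_algebraMap (c : ℂ) : ofConv (algebraMap ℂ ConvSeries c) = algebraMap ℂ MicroRing c := by
  refine Subtype.ext ?_
  have h : (algebraMap ℂ FormalOp c) = (single 0 (PowerSeries.C c) : Symbol) := by
    rw [Algebra.algebraMap_eq_smul_one]
    exact (smul_eq_single_mul c (1 : Symbol)).trans (mul_one _)
  exact h.symm

theorem dT_t : dT (single (-1) 1) = 1 := by
  ext1; funext n
  rw [dT_coeff]
  by_cases h : n = 0
  · subst h; simp
  · rw [coeff_single_of_ne (by omega), smul_zero, ← single_zero_one, coeff_single_of_ne h]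

theorem star_t_const (a : PowerSeries ℂ) : star (single (-1) 1) (single 0 a) =
    star (single 0 a) (single (-1) 1) + single 0 (PowerSeries.derivative ℂ a) := by
  rw [star_of_dT_dT_eq_zero (by rw [dT_t, dT_one]), dT_t, dEta_single, one_mul, mul_comm,
    star_of_dT_eq_zero (dT_single_zero a)]

theorem t_mul_ofConv (a : ConvSeries) : t * ofConv a = ofConv a * t + ofConv a.deriv :=
  Subtype.ext (star_t_const (a : PowerSeries ℂ))

theorem t_mul_eta : t * eta = eta * t + 1 := by
  rw [eta, t_mul_ofConv]
  congr 1
  refine Subtype.ext ?_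
  show single 0 (PowerSeries.derivative ℂ PowerSeries.X) = (1 : Symbol)
  rw [PowerSeries.derivative_X, single_zero_one]

end MicroRing

/-- Generators of the Weyl algebra: a coordinate `x` and its derivation `d`. -/
inductive WeylGen : Type
  | x : WeylGen
  | d : WeylGen

/-- The defining relation `d x = x d + 1`. -/
inductive WeylRel : FreeAlgebra ℂ WeylGen → FreeAlgebra ℂ WeylGen → Prop
  | comm : WeylRel (FreeAlgebra.ι ℂ WeylGen.d * FreeAlgebra.ι ℂ WeylGen.x)
      (FreeAlgebra.ι ℂ WeylGen.x * FreeAlgebra.ι ℂ WeylGen.d + 1)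

/-- The Weyl algebra `ℂ[x]⟨∂_x⟩` of the affine line. It serves both as `W_t` (coordinate `t`) and as
`W_η` (coordinate `η`). -/
def Weyl : Type := RingQuot WeylRel

instance : Ring Weyl := inferInstanceAs (Ring (RingQuot WeylRel))

instance : Algebra ℂ Weyl := inferInstanceAs (Algebra ℂ (RingQuot WeylRel))

namespace Weyl

/-- The quotient map from the free algebra. -/
def mk : FreeAlgebra ℂ WeylGen →ₐ[ℂ] Weyl := RingQuot.mkAlgHom ℂ WeylRel

/-- The coordinate. -/
def x : Weyl := mk (FreeAlgebra.ι ℂ WeylGen.x)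

/-- The derivation `∂_x`. -/
def d : Weyl := mk (FreeAlgebra.ι ℂ WeylGen.d)

theorem d_mul_x : d * x = x * d + 1 := by
  have h : mk _ = mk _ := RingQuot.mkAlgHom_rel ℂ WeylRel.comm
  rwa [map_add, map_mul, map_mul, map_one] at h

/-- The morphism of algebras `x ↦ a`, `∂_x ↦ b`, for `b a = a b + 1`. -/
def lift {A : Type*} [Ring A] [Algebra ℂ A] (a b : A) (h : b * a = a * b + 1) : Weyl →ₐ[ℂ] A :=
  RingQuot.liftAlgHom ℂ ⟨FreeAlgebra.lift ℂ fun g => match g with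
    | WeylGen.x => a
    | WeylGen.d => b, by
      rintro _ _ ⟨⟩
      simpa using h⟩

theorem lift_x {A : Type*} [Ring A] [Algebra ℂ A] (a b : A) (h : b * a = a * b + 1) :
    lift a b h x = a :=
  (RingQuot.liftAlgHom_mkAlgHom_apply ℂ _ _ _).trans (FreeAlgebra.lift_ι_apply _ _)

theorem lift_d {A : Type*} [Ring A] [Algebra ℂ A] (a b : A) (h : b * a = a * b + 1) :
    lift a b h d = b :=
  (RingQuot.liftAlgHom_mkAlgHom_apply ℂ _ _ _).trans (FreeAlgebra.lift_ι_apply _ _)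

end Weyl

/-- The Fourier morphism `W_t → W_η`, `t ↦ -∂_η`, `∂_t ↦ η`. -/
def fourier : Weyl →ₐ[ℂ] Weyl :=
  Weyl.lift (-Weyl.d) Weyl.x (by
    rw [mul_neg, neg_mul, Weyl.d_mul_x]; abel)

/-- `φ^(∞,0) : W_t → E^(∞,0)`, `t ↦ -t`, `∂_t ↦ η`. -/
def phi : Weyl →ₐ[ℂ] MicroRing :=
  Weyl.lift (-MicroRing.t) MicroRing.eta (by
    rw [mul_neg, neg_mul, MicroRing.t_mul_eta]; abel)

/-- `μ : W_η → E^(∞,0)`, `η ↦ η`, `∂_η ↦ t`. -/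
def mu : Weyl →ₐ[ℂ] MicroRing := Weyl.lift MicroRing.eta MicroRing.t MicroRing.t_mul_eta

/-- The defining relations of the ring `ℂ{η}⟨∂_η⟩`; the generator `some a` stands for the function
`a ∈ ℂ{η}`, the generator `none` for `∂_η`. -/
inductive ConvDiffRel :
    FreeAlgebra ℂ (Option ConvSeries) → FreeAlgebra ℂ (Option ConvSeries) → Prop
  | add (a b : ConvSeries) : ConvDiffRel (FreeAlgebra.ι ℂ (some (a + b)))
      (FreeAlgebra.ι ℂ (some a) + FreeAlgebra.ι ℂ (some b))
  | mul (a b : ConvSeries) : ConvDiffRel (FreeAlgebra.ι ℂ (some (a * b)))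
      (FreeAlgebra.ι ℂ (some a) * FreeAlgebra.ι ℂ (some b))
  | const (c : ℂ) : ConvDiffRel (FreeAlgebra.ι ℂ (some (algebraMap ℂ ConvSeries c)))
      (algebraMap ℂ _ c)
  | comm (a : ConvSeries) : ConvDiffRel (FreeAlgebra.ι ℂ none * FreeAlgebra.ι ℂ (some a))
      (FreeAlgebra.ι ℂ (some a) * FreeAlgebra.ι ℂ none + FreeAlgebra.ι ℂ (some a.deriv))

/-- The ring `ℂ{η}⟨∂_η⟩` of differential operators with convergent coefficients: it is generated over
`ℂ{η}` by `∂_η`, with the relations `∂_η a = a ∂_η + a'`. -/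
def ConvDiff : Type := RingQuot ConvDiffRel

instance : Ring ConvDiff := inferInstanceAs (Ring (RingQuot ConvDiffRel))

instance : Algebra ℂ ConvDiff := inferInstanceAs (Algebra ℂ (RingQuot ConvDiffRel))

/-- The morphism `ℂ{η}⟨∂_η⟩ → E^(∞,0)` that is the inclusion on `ℂ{η}` and sends `∂_η` to `t`. -/
def ConvDiff.toMicro : ConvDiff →ₐ[ℂ] MicroRing :=
  RingQuot.liftAlgHom ℂ ⟨FreeAlgebra.lift ℂ fun g => match g with
    | some a => MicroRing.ofConv a
    | none => MicroRing.t, by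
      rintro _ _ (⟨a, b⟩ | ⟨a, b⟩ | ⟨c⟩ | ⟨a⟩)
      · simpa using MicroRing.ofConv_add a b
      · simpa using MicroRing.ofConv_mul a b
      · simpa using MicroRing.ofConv_algebraMap c
      · simpa using MicroRing.t_mul_ofConv a⟩

theorem dEta_map_C (f : LaurentSeries ℂ) : dEta (f.map (PowerSeries.C (R := ℂ))) = 0 := by
  ext1; funext n
  rw [dEta_coeff, HahnSeries.map_coeff]
  exact PowerSeries.derivative_C

theorem isMicro_map_C {s : ℝ≥0} (hs : s ≤ 1) {f : LaurentSeries ℂ} (hf : f ∈ GevreyField s) :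
    IsMicro (f.map (PowerSeries.C (R := ℂ))) := by
  obtain ⟨k, g, hg, rfl⟩ := hf
  obtain ⟨C, R, hC, hR, h⟩ := (isGevrey_iff s g).mp hg
  have hR0 : 0 < R := by linarith
  refine Maj.isMicro (r := k) (fun n hn => ?_) ⟨C, R, hC, hR, fun m n => ?_⟩
  · obtain ⟨j, rfl⟩ : ∃ j, n = j + (-k : ℤ) := ⟨n + k, by omega⟩
    rw [HahnSeries.map_coeff, coeff_single_mul_add, one_mul, ofPowerSeries_apply,
      embDomain_of_notMem_range, map_zero]
    simp only [Nat.castOrderEmbedding_apply, Set.mem_range, not_exists]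
    intro x hx
    have : ((x : ℕ) : ℤ) = j := hx
    omega
  · rw [HahnSeries.map_coeff, add_comm (-k : ℤ), coeff_single_mul_add, one_mul,
      ofPowerSeries_apply_coeff, PowerSeries.coeff_C]
    split_ifs with hn
    · subst hn
      refine (h m).trans ?_
      rw [add_zero]
      refine mul_le_mul_of_nonneg_left ?_ (by positivity)
      have h1 : (1 : ℝ) ≤ m.factorial := by exact_mod_cast m.factorial_pos
      calc _ ≤ (m.factorial : ℝ) ^ (1 : ℝ) :=
            Real.rpow_le_rpow_of_exponent_le h1 (by exact_mod_cast hs)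
        _ = _ := Real.rpow_one _
    · rw [norm_zero]; positivity

/-- The inclusion into `E^(∞,0)` of the field of `s`-Gevrey Laurent series in `t⁻¹`, for `s ≤ 1`. -/
def GevreyField.toMicro (s : ℝ≥0) (hs : s ≤ 1) : GevreyField s →+* MicroRing where
  toFun f := ⟨((f : LaurentSeries ℂ).map (PowerSeries.C (R := ℂ)) : Symbol), isMicro_map_C hs f.2⟩
  map_one' := by
    refine Subtype.ext ?_
    exact HahnSeries.map_one (PowerSeries.C (R := ℂ)).toMonoidWithZeroHom
  map_mul' f g := by
    refine Subtype.ext (Eq.symm ?_)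
    refine (star_of_dEta_eq_zero (dEta_map_C _) _).trans ?_
    exact (HahnSeries.map_mul (PowerSeries.C (R := ℂ)).toNonUnitalRingHom).symm
  map_zero' := by
    refine Subtype.ext ?_
    exact HahnSeries.map_zero (PowerSeries.C (R := ℂ)).toZeroHom
  map_add' f g := by
    refine Subtype.ext ?_
    exact HahnSeries.map_add (PowerSeries.C (R := ℂ)).toAddMonoidHom

/-- The field `ℂ{t⁻¹}[t]` of convergent Laurent series in `t⁻¹`. -/
abbrev ConvLaurent : Type := GevreyField 0

section BaseChange

variable {R S : Type} [Ring R] [Ring S] (f : R →+* S) (M : Type*) [AddCommGroup M] [Module R M]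

/-- The relations `s f(r) ⊗ m = s ⊗ r m`. -/
def balanced : Submodule S (S ⊗[ℤ] M) :=
  Submodule.span S {y | ∃ (s : S) (r : R) (m : M), y = (s * f r) ⊗ₜ[ℤ] m - s ⊗ₜ[ℤ] (r • m)}

/-- The left `S`-module `S ⊗_R M`, where `S` is a right `R`-module through `f : R → S`. -/
def BaseChange : Type _ := (S ⊗[ℤ] M) ⧸ balanced f M

instance : AddCommGroup (BaseChange f M) :=
  inferInstanceAs (AddCommGroup ((S ⊗[ℤ] M) ⧸ balanced f M))

instance : Module S (BaseChange f M) :=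
  inferInstanceAs (Module S ((S ⊗[ℤ] M) ⧸ balanced f M))

variable {M}

/-- The element `s ⊗ m` of `S ⊗_R M`. -/
def BaseChange.tmul (s : S) (m : M) : BaseChange f M := (balanced f M).mkQ (s ⊗ₜ[ℤ] m)

end BaseChange

section Action

variable {R : Type} [Ring R] (f : R →+* MicroRing) (M : Type*) [AddCommGroup M] [Module R M]

/-- `ℂ{η}⟨∂_η⟩` acts on `E^(∞,0) ⊗_R M` by left multiplication; `∂_η` acts as `t`. -/
instance : Module ConvDiff (BaseChange f M) :=
  Module.compHom _ ConvDiff.toMicro.toRingHom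

/-- `ℂ{t⁻¹}[t]` acts on `E^(∞,0) ⊗_R M` by left multiplication. -/
instance : Module ConvLaurent (BaseChange f M) :=
  Module.compHom _ (GevreyField.toMicro 0 zero_le_one)

/-- The field of `1`-Gevrey Laurent series in `t⁻¹` acts on `E^(∞,0) ⊗_R M` by left
multiplication. -/
instance : Module (GevreyField 1) (BaseChange f M) :=
  Module.compHom _ (GevreyField.toMicro 1 le_rfl)

end Action

section Modules

variable (M : Type*) [AddCommGroup M] [Module Weyl M]

/-- Holonomic modules: every element is annihilated by a nonzero operator. -/
def IsHolonomic : Prop := ∀ m : M, ∃ P : Weyl, P ≠ 0 ∧ P • m = 0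

/-- The Fourier transform `M̂ = W_η ⊗_{W_t} M`. -/
abbrev FourierTransform : Type _ := BaseChange fourier.toRingHom M

/-- The element `m̂ = 1 ⊗ m` of the Fourier transform. -/
def hat {M : Type*} [AddCommGroup M] [Module Weyl M] (m : M) : FourierTransform M :=
  BaseChange.tmul fourier.toRingHom 1 m

/-- `E^(∞,0)(M) = E^(∞,0) ⊗_{W_t} M`, through `φ^(∞,0)`. -/
abbrev MicroInfZero : Type _ := BaseChange phi.toRingHom M

/-- `μ(N) = E^(∞,0) ⊗_{W_η} N`, through `μ`. -/
abbrev MicroMu (N : Type*) [AddCommGroup N] [Module Weyl N] : Type _ := BaseChange mu.toRingHom N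

end Modules

end LocalFourier

end

/-! The statement is transitivity of extension of scalars, applied to two composable ring morphisms
whose composite is known. Write 𝓔 for `MicroRing`, F for `fourier`. The source of Υ⁰ is 𝓔 ⊗_{W_η}
(W_η ⊗_{W_t} M), where W_η is a right W_t-module through F and 𝓔 a right W_η-module through μ.
Cancelling W_η gives 𝓔 ⊗_{W_t} M, where W_t now acts on the right of 𝓔 through μ ∘ F. On the
generators, μ ∘ F sends t ↦ -∂_η ↦ -t and ∂_t ↦ η ↦ η, which is the definition of φ^(∞,0). Hence the
result of the cancellation is 𝓔^(∞,0)(M).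

The cancellation α ⊗ (P ⊗ m) ↦ α μ(P) ⊗ m is left 𝓔-linear and sends α ⊗ m̂ = α ⊗ (1 ⊗ m) to α ⊗ m.
All three module structures in the statement are pulled back from left multiplication by 𝓔 along
ring morphisms into 𝓔, so 𝓔-linearity yields the three compatibilities at once. The growth estimates
enter only through the fact that 𝓔 is a ring containing the images of these morphisms.

The rings are noncommutative, so the tensor product is the concrete quotient `BaseChange` of S ⊗_ℤ
M. Its universal property is split into existence (`BaseChange.lift`) and uniqueness
(`BaseChange.hom_ext`). Applied twice, these give the mutually inverse maps `transHom` and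
`transInv`, which are assembled in `BaseChange.trans`; the identity of morphisms is
`mu_comp_fourier`. -/

namespace LocalFourier

/-! ### The universal property of S ⊗_R M over noncommutative rings. -/

namespace BaseChange

section

variable {R S : Type} [Ring R] [Ring S] (f : R →+* S) {M N : Type*} [AddCommGroup M] [Module R M]
  [AddCommGroup N] [Module S N]

/-- The pure tensor `s ⊗ m` as an additive function of `m`. -/
def tmulHom (s : S) : M →+ BaseChange f M where
  toFun m := tmul f s m
  map_zero' := (congrArg (balanced f M).mkQ (TensorProduct.tmul_zero M s)).trans (map_zero _)
  map_add' m m' := (congrArg (balanced f M).mkQ (TensorProduct.tmul_add s m m')).trans (map_add _ _ _)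

/-- S acts on the left factor of S ⊗_ℤ M, and the quotient map is S-linear because the relations
generate an S-submodule. -/
theorem smul_tmul (s s' : S) (m : M) : s • tmul f s' m = tmul f (s * s') m := by
  rw [tmul, tmul, ← smul_eq_mul, ← TensorProduct.smul_tmul', map_smul]
  rfl

/-- This is the defining relation of the quotient. With `smul_tmul` it carries every scalar
computation below: an element of R first crosses the tensor sign through f, then becomes a left
factor. -/
theorem tmul_smul (s : S) (r : R) (m : M) : tmul f s (r • m) = tmul f (s * f r) m := by
  refine Eq.symm ((Submodule.Quotient.eq _).mpr ?_)
  exact Submodule.subset_span ⟨s, r, m, rfl⟩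

/-- The `S`-linear map `s ⊗ m ↦ s φ(m)` induced by a map `φ` that is semilinear along `f`. -/
def lift (φ : M →+ N) (hφ : ∀ (r : R) (m : M), φ (r • m) = f r • φ m) :
    BaseChange f M →ₗ[S] N :=
  (balanced f M).liftQ
    -- The tensor product underneath is over ℤ, so the map is first built from the biadditive
    -- pairing (s, m) ↦ s φ(m); its S-linearity is checked separately on pure tensors.
    { toFun := TensorProduct.liftAddHom
        { toFun := fun s => (DistribSMul.toAddMonoidHom N s).comp φ
          map_zero' := by ext m; simp
          map_add' := fun s s' => by ext m; simp [add_smul] }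
        -- Balancedness over ℤ, that is (n s) φ(m) = s φ(n m), holds because integers are central in
        -- S.
        (fun n s m => by
          simp [(Int.cast_commute n s).eq, mul_smul, Int.cast_smul_eq_zsmul])
      map_add' := fun y y' => map_add _ y y'
      map_smul' := fun s y => by
        induction y using TensorProduct.induction_on with
        | zero => simp
        | tmul s' m => simp [TensorProduct.smul_tmul', mul_smul]
        | add y y' hy hy' => rw [smul_add, map_add, hy, hy', map_add, smul_add] } <| by
    -- The map is S-linear, so it is enough that it kills the generating relations: s f(r) φ(m) = s
    -- φ(r m) is the semilinearity of φ.
    rw [balanced, Submodule.span_le]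
    rintro _ ⟨s, r, m, rfl⟩
    simp [hφ, mul_smul]

variable {f}

/-- Since s ⊗ m = s (1 ⊗ m), the elements 1 ⊗ m generate S ⊗_R M over S. This is the uniqueness half
of the universal property. -/
theorem hom_ext {φ ψ : BaseChange f M →ₗ[S] N} (h : ∀ m, φ (tmul f 1 m) = ψ (tmul f 1 m)) :
    φ = ψ := by
  ext y
  obtain ⟨y, rfl⟩ := (balanced f M).mkQ_surjective y
  induction y using TensorProduct.induction_on with
  | zero => exact (map_zero φ).trans (map_zero ψ).symm
  | tmul s m =>
    change φ (tmul f s m) = ψ (tmul f s m)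
    rw [← mul_one s, ← smul_tmul, map_smul, map_smul, h]
  | add y y' hy hy' =>
    rw [map_add]
    exact (map_add φ _ _).trans ((congrArg₂ (· + ·) hy hy').trans (map_add ψ _ _).symm)

end

/-! ### Transitivity of extension of scalars. The composite is a separate morphism h with g ∘ f = h
pointwise, so that the target is literally the base change along h. -/

section Trans

variable {R S T : Type} [Ring R] [Ring S] [Ring T] (f : R →+* S) (g : S →+* T) (h : R →+* T)
  (hgf : ∀ r, g (f r) = h r) (M : Type*) [AddCommGroup M] [Module R M]

/-- The map `t ⊗ (s ⊗ m) ↦ t g(s) ⊗ m`. -/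
def transHom : BaseChange g (BaseChange f M) →ₗ[T] BaseChange h M :=
  -- T ⊗_R M becomes an S-module through g, so that the universal property of S ⊗_R M applies with
  -- it as target.
  letI : Module S (BaseChange h M) := Module.compHom _ g
  let φ : BaseChange f M →ₗ[S] BaseChange h M := lift f (tmulHom h 1) fun r m => by
    change tmul h 1 (r • m) = g (f r) • tmul h 1 m
    -- Both sides equal h(r) ⊗ m; this is where g ∘ f = h makes m ↦ 1 ⊗ m semilinear along f.
    rw [tmul_smul, smul_tmul, one_mul, mul_one, hgf]
  -- Because S acts on the target through g, the S-linearity of φ is exactly the semilinearity along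
  -- g required by the second lift.
  lift g φ.toAddMonoidHom fun s y => φ.map_smul s y

/-- Each of the two nested lifts multiplies by its left factor, so a pure tensor goes to t (g(s) (1
⊗ m)). This recovers the explicit formula from the construction. -/
theorem transHom_tmul_tmul (t : T) (s : S) (m : M) :
    transHom f g h hgf M (tmul g t (tmul f s m)) = tmul h (t * g s) m := by
  change t • (g s • tmul h 1 m) = _
  rw [smul_tmul, smul_tmul, mul_one]

/-- The map `t ⊗ m ↦ t ⊗ (1 ⊗ m)`. -/
def transInv : BaseChange h M →ₗ[T] BaseChange g (BaseChange f M) :=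
  lift h ((tmulHom g 1).comp (tmulHom f 1)) fun r m => by
    change tmul g 1 (tmul f 1 (r • m)) = h r • tmul g 1 (tmul f 1 m)
    -- The scalar r travels through both tensor signs: 1 ⊗ (1 ⊗ r m) = 1 ⊗ f(r) (1 ⊗ m) = g(f(r)) ⊗
    -- (1 ⊗ m), and g(f(r)) = h(r).
    rw [tmul_smul, one_mul, ← mul_one (f r), ← smul_tmul, tmul_smul, smul_tmul, one_mul, mul_one,
      hgf]

theorem transInv_tmul (t : T) (m : M) :
    transInv f g h hgf M (tmul h t m) = tmul g t (tmul f 1 m) := by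
  change t • tmul g 1 (tmul f 1 m) = _
  rw [smul_tmul, mul_one]

/-- Transitivity of the change of rings: `T ⊗_S (S ⊗_R M) ≃ T ⊗_R M`. -/
def trans : BaseChange g (BaseChange f M) ≃ₗ[T] BaseChange h M :=
  LinearEquiv.ofLinearMap (transHom f g h hgf M) (transInv f g h hgf M)
    (hom_ext fun m => by
      rw [LinearMap.comp_apply, transInv_tmul, transHom_tmul_tmul, map_one, mul_one,
        LinearMap.id_apply])
    -- For `transInv` after `transHom`, T-linearity reduces the claim to tensors 1 ⊗ y, but y is
    -- still an arbitrary element of S ⊗_R M. A second reduction, now over S, brings y down to 1 ⊗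
    -- m.
    (hom_ext fun y => by
      rw [LinearMap.comp_apply, LinearMap.id_apply]
      let _ : Module S (BaseChange g (BaseChange f M)) := Module.compHom _ g
      -- With S acting on the outer tensor product through g, y ↦ 1 ⊗ y is S-linear because 1 ⊗ s y
      -- = g(s) ⊗ y.
      let φ : BaseChange f M →ₗ[S] BaseChange g (BaseChange f M) :=
        { toFun := fun y => tmul g 1 y
          map_add' := (tmulHom g 1).map_add
          map_smul' := fun s y => by
            change tmul g 1 (s • y) = g s • tmul g 1 y
            rw [tmul_smul, smul_tmul, one_mul, mul_one] }
      -- This is the round trip with its T-linearity restricted to S along g; the claim for 1 ⊗ y is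
      -- then the equality of the S-linear maps ψ ∘ φ and φ.
      let ψ : BaseChange g (BaseChange f M) →ₗ[S] BaseChange g (BaseChange f M) :=
        { toFun := fun y => transInv f g h hgf M (transHom f g h hgf M y)
          map_add' := fun y y' => by rw [map_add, map_add]
          map_smul' := fun s y => by
            change transInv f g h hgf M (transHom f g h hgf M (g s • y)) = g s • _
            rw [map_smul, map_smul] }
      refine LinearMap.congr_fun (f := ψ.comp φ) (g := φ) (hom_ext fun m => ?_) y
      change transInv f g h hgf M (transHom f g h hgf M (tmul g 1 (tmul f 1 m))) =
        tmul g 1 (tmul f 1 m)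
      rw [transHom_tmul_tmul, transInv_tmul, map_one, mul_one])

theorem trans_tmul_tmul (t : T) (s : S) (m : M) :
    trans f g h hgf M (tmul g t (tmul f s m)) = tmul h (t * g s) m :=
  transHom_tmul_tmul f g h hgf M t s m

end Trans

end BaseChange

/-! ### The morphisms out of the Weyl algebra, and the isomorphism Υ⁰. -/

/-- The Weyl algebra is a quotient of the free algebra on x and ∂_x, so a morphism out of it is
determined by its values there. -/
theorem Weyl.hom_ext {A : Type*} [Ring A] [Algebra ℂ A] {φ ψ : Weyl →ₐ[ℂ] A}
    (hx : φ Weyl.x = ψ Weyl.x) (hd : φ Weyl.d = ψ Weyl.d) : φ = ψ := by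
  refine RingQuot.ringQuot_ext' ℂ _ _ (FreeAlgebra.hom_ext (funext fun g => ?_))
  cases g
  · exact hx
  · exact hd

/-- The only fact specific to the Fourier transform: the sign in t ↦ -∂_η is the sign in φ^(∞,0)(t)
= -t, because μ sends ∂_η to t. -/
theorem mu_comp_fourier : mu.comp fourier = phi := by
  refine Weyl.hom_ext ?_ ?_
  · rw [AlgHom.comp_apply, fourier, phi, Weyl.lift_x, Weyl.lift_x, map_neg, mu, Weyl.lift_d]
  · rw [AlgHom.comp_apply, fourier, phi, Weyl.lift_d, Weyl.lift_d, mu, Weyl.lift_x]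

end LocalFourier

/-- The isomorphism is stated as an additive one because three different rings of scalars act;
behind it stands a single equivalence linear over `MicroRing`. -/
theorem mainTheorem7 {M : Type*} [AddCommGroup M] [Module LocalFourier.Weyl M]
    (hM : LocalFourier.IsHolonomic M) :
    ∃ Υ : LocalFourier.MicroMu (LocalFourier.FourierTransform M) ≃+ LocalFourier.MicroInfZero M,
      (∀ (α : LocalFourier.MicroRing) (m : M),
        Υ (LocalFourier.BaseChange.tmul LocalFourier.mu.toRingHom α (LocalFourier.hat m)) =
          LocalFourier.BaseChange.tmul LocalFourier.phi.toRingHom α m) ∧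
      (∀ (L : LocalFourier.ConvDiff)
        (y : LocalFourier.MicroMu (LocalFourier.FourierTransform M)), Υ (L • y) = L • Υ y) ∧
      (∀ (c : LocalFourier.ConvLaurent)
        (y : LocalFourier.MicroMu (LocalFourier.FourierTransform M)), Υ (c • y) = c • Υ y) ∧
      (∀ (c : LocalFourier.GevreyField 1)
        (y : LocalFourier.MicroMu (LocalFourier.FourierTransform M)), Υ (c • y) = c • Υ y) := by
  have hgf : ∀ P, LocalFourier.mu.toRingHom (LocalFourier.fourier.toRingHom P) =
      LocalFourier.phi.toRingHom P := DFunLike.congr_fun LocalFourier.mu_comp_fourier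
  let Υ := LocalFourier.BaseChange.trans LocalFourier.fourier.toRingHom LocalFourier.mu.toRingHom
    LocalFourier.phi.toRingHom hgf M
  -- An element L or c acts, by definition, as its image in `MicroRing` acts by left multiplication,
  -- so each compatibility is an instance of the linearity of Υ over that ring.
  refine ⟨Υ.toAddEquiv, fun α m => ?_, fun L y => Υ.map_smul _ y, fun c y => Υ.map_smul _ y,
    fun c y => Υ.map_smul _ y⟩
  -- Here m̂ = 1 ⊗ m, so the general formula applies with s = 1 and gives α μ(1) ⊗ m = α ⊗ m.
  refine (LocalFourier.BaseChange.trans_tmul_tmul _ _ _ hgf M α 1 m).trans ?_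
  rw [map_one, mul_one]
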